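/- **Setting.** For every security parameter $\lambda$ let $p=p(\lambda)$ be a prime, $\kappa=\lceil\log_2 p\rceil$, and suppose $2\kappa<\lambda$ for all large $\lambda$. Elements of $\mathbb F_p$ are written with $\kappa$ bits, $x=\sum_{i=1}^{\kappa}x[i]2^{i-1}$. Let $\mathrm{sign}(t)=1$ if the representative of $t$ in $(-p/2,p/2]$ is $\ge 0$ and $\mathrm{sign}(t)=0$ otherwise, and $f(t)=t\cdot\mathrm{sign}(t)$ (ReLU). "Efficient" means computed by circuits with $\lambda^{O(1)}$ Boolean gates and gates for the arithmetic and bits of $\mathbb F_p$ (non-uniform; adversaries and simulators also get random bits and field elements), and $X\approx Y$ up to $\varepsilon$ means that for every efficient distinguisher $D$ there is a negligible $\nu$ with $|\Pr[D(X)=1]-\Pr[D(Y)=1]|\le\nu(\lambda)+\varepsilon(\lambda)$; $\approx$ alone means $\varepsilon=0$. **Garbling scheme.** $\mathtt{Garble}(1^\lambda,C)$ outputs a garbled circuit $\mathtt{GC}$ and labels $\mathtt{lab}^{in}_{i,j},\mathtt{lab}^{out}_{i,j}\in\{0,1\}^\lambda$, $j\in\{0,1\}$, for the input and output wires of a Boolean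 circuit $C$; $\mathtt{GCEval}$ is efficient and deterministic. Write a label as $\xi\|\zeta$ with $\xi\in\{0,1\}$. Assume, always: $\mathtt{GCEval}(\mathtt{GC},\{\mathtt{lab}^{in}_{i,x[i]}\}_i)=\{\mathtt{lab}^{out}_{i,C(x)[i]}\}_i$ (correctness); $\xi_{i,1}\ne\xi_{i,0}$ for the two labels of an output wire (point-and-permute). Assume for every polynomial-size family $C$: there is an efficient $\mathtt{Sim}$ such that for all inputs $x$, $(\mathtt{GC},\{\mathtt{lab}^{in}_{i,x[i]}\}_i)\approx\mathtt{Sim}$ (security); and for all $x$, jointly with $(\mathtt{GC},\{\mathtt{lab}^{in}_{i,x[i]}\}_i)$, the labels $\{\mathtt{lab}^{out}_{i,1-C(x)[i]}\}_i$ are $\approx$ independent labels whose first bit is the complement of that of $\mathtt{lab}^{out}_{i,C(x)[i]}$ and whose other $\lambda-1$ bits are uniform (authenticity). **Protocol $\pi^f_{\mathsf{Non\text{-}lin}}$.** $S_0$ holds $\langle u\rangle_0\in\mathbb F_p$ and a uniform MAC key $\alpha\in\mathbb F_p$; $S_1$ holds $\langle u\rangle_1$; $u=\langle u\rangle_0+\langle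 u\rangle_1$. Let $booln^f$ be a polynomial-size family of Boolean circuits computing the $\kappa$ bits of $u$ and the $\kappa$ bits of $\mathrm{sign}(u)$ from two $\kappa$-bit strings that represent the shares modulo $p$. Oblivious transfer and triple generation are ideal. 1. $S_0$ garbles $booln^f$. $S_1$ gets the labels of its own input bits by oblivious transfer, and $\mathtt{GC}$ and the labels of the bits of $\langle u\rangle_0$ from $S_0$; it evaluates $\mathtt{GC}$. 2. For $i\le\kappa$, $S_0$ picks uniform $\rho_{i,0},\sigma_{i,0},\tau_{i,0}\in\mathbb F_p$, puts $(\rho_{i,1},\sigma_{i,1},\tau_{i,1})=(1+\rho_{i,0},\alpha+\sigma_{i,0},\alpha+\tau_{i,0})$ and sends, for $j\in\{0,1\}$, $ct_{i,\xi_{i,j}}=\tau_{i,j}\oplus\mathbf{Trun}_\kappa(\zeta_{i,j})$ and $\hat{ct}_{i,\xi_{i+\kappa,j}}=(\rho_{i,j}\|\sigma_{i,j})\oplus\mathbf{Trun}_{2\kappa}(\zeta_{i+\kappa,j})$, where $\xi_{i,j}\|\zeta_{i,j}=\mathtt{lab}^{out}_{i,j}$ and $\mathbf{Trun}_h$ takes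 the last $h$ bits. $S_1$ decrypts one ciphertext of each pair to $c_i$ and $d_i\|e_i$. 3. $S_0$ sets $\langle g_1\rangle_0,\langle g_2\rangle_0,\langle g_3\rangle_0$ to $-\sum_i\tau_{i,0}2^{i-1}$, $-\sum_i\rho_{i,0}2^{i-1}$, $-\sum_i\sigma_{i,0}2^{i-1}$, and $S_1$ sets $\langle g_1\rangle_1,\langle g_2\rangle_1,\langle g_3\rangle_1$ to $\sum_i c_i2^{i-1}$, $\sum_i d_i2^{i-1}$, $\sum_i e_i2^{i-1}$ (shares of $\alpha u$, $\mathrm{sign}(u)$, $\alpha\,\mathrm{sign}(u)$). 4. The parties obtain authenticated shares of a triple $AB=C$: $S_1$ contributes $\langle A\rangle_1,\langle B\rangle_1$, the shares of $S_0$ of $A,B,C,\alpha A,\alpha B,\alpha C$ are uniform, and $S_1$ gets the matching shares of $C,\alpha A,\alpha B,\alpha C$. They reveal $\Gamma=u-A$ and $\Lambda=g_2-B$ as authenticated values: $S_0$ sends its shares of $\Gamma,\Lambda$; $S_1$ sends its shares of $\Gamma,\alpha\Gamma,\Lambda,\alpha\Lambda$; $S_0$ aborts unless the reconstructed MACs equal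 $\alpha\Gamma$ and $\alpha\Lambda$, where $\langle\alpha\Gamma\rangle=\langle g_1\rangle-\langle\alpha A\rangle$ and $\langle\alpha\Lambda\rangle=\langle g_3\rangle-\langle\alpha B\rangle$. Each $S_b$ outputs $\langle g_1\rangle_b$ and the shares $\langle C\rangle_b+\Gamma\langle B\rangle_b+\Lambda\langle A\rangle_b$ of $f(u)$ and $\langle\alpha C\rangle_b+\Gamma\langle\alpha B\rangle_b+\Lambda\langle\alpha A\rangle_b$ of $\alpha f(u)$, to which $S_0$ adds $\Gamma\Lambda$ and $\alpha\Gamma\Lambda$, respectively. **Ideal execution.** The simulator $\mathcal S$ chooses $\langle u\rangle_1$; the functionality gives $S_1$ uniform shares of $\alpha u,f(u),\alpha f(u)$ and the complementary shares to $S_0$, unless $\mathcal S$ makes $S_0$ abort; $\mathcal S$ outputs a view. **Theorem 4.1.** For every efficient malicious adversary $\mathcal A$ corrupting $S_1$ (it chooses its bits in the oblivious transfers, then $\langle A\rangle_1,\langle B\rangle_1$, then, after seeing the shares of $\Gamma,\Lambda$ of $S_0$, its last message, arbitrarily from everything seen so far, and may abort), there is an efficient simulator $\mathcal S$ such that for every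 family of inputs $\langle u\rangle_0$ of $S_0$: $$(\alpha,\mathrm{View}_{\mathcal A})_{\mathrm{real}}\approx(\alpha,\mathrm{View}_{\mathcal S})_{\mathrm{ideal}},$$ $$(\alpha,\mathrm{Out}_{S_0},\mathrm{View}_{\mathcal A})_{\mathrm{real}}\approx(\alpha,\mathrm{Out}_{S_0},\mathrm{View}_{\mathcal S})_{\mathrm{ideal}}\quad\text{up to }2^{-\lfloor\log_2 p\rfloor}.$$ -/

import Mathlib

open Filter

namespace NonLin

/-! ## Bit strings and field elements -/

/-- `{0,1}^n`. -/
abbrev BitStr (n : ℕ) : Type := Fin n → Bool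

/-- The bit length `κ = ⌈log₂ q⌉` of the elements of `𝔽_q`. -/
def kappa (q : ℕ) : ℕ := Nat.clog 2 q

/-- The `κ` bits of the canonical representative of `x ∈ 𝔽_q` (least significant bit first). -/
def bitsOf {q : ℕ} (x : ZMod q) : BitStr (kappa q) := fun i => x.val.testBit i

/-- `∑ b[i] 2^i ∈ 𝔽_q`; every bit string is accepted, the value is reduced modulo `q`. -/
def ofBits (q : ℕ) {n : ℕ} (b : BitStr n) : ZMod q := ∑ i : Fin n, if b i then 2 ^ (i : ℕ) else 0

/-- `∑ w[i] 2^i` for field elements `w[i]`. -/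
def weighted {q n : ℕ} (w : Fin n → ZMod q) : ZMod q := ∑ i : Fin n, w i * 2 ^ (i : ℕ)

/-- Bitwise exclusive or. -/
def bxor {n : ℕ} (x y : BitStr n) : BitStr n := fun i => xor (x i) (y i)

/-- `Trun_h`: the last `h` bits of a bit string (meaningful for `h ≤ n`). -/
def trun (h : ℕ) {n : ℕ} (z : BitStr n) : BitStr h :=
  fun i => if hi : n - h + i < n then z ⟨n - h + i, hi⟩ else false

/-- `sign t = 1` if `t ≥ 0` and `0` otherwise; order on `𝔽_q` is that of the signed representative
in `(-q/2, q/2]`. -/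
def sgn {q : ℕ} (t : ZMod q) : ZMod q := if 0 ≤ t.valMinAbs then 1 else 0

/-- `ReLU(t) = t · sign(t)`. -/
def relu {q : ℕ} (t : ZMod q) : ZMod q := t * sgn t

/-- The uniform distribution on a finite non-empty type. -/
noncomputable def unif (T : Type) [Fintype T] [Nonempty T] : PMF T := PMF.uniformOfFintype T

/-! ## Efficient computation

The adversaries, simulators and distinguishers are non-uniform: families of circuits of polynomial
size, one for each security parameter. -/

/-- Circuits with Boolean gates and gates for the arithmetic of `𝔽_q`, from a bundle of wires of
type `X` to a bundle of wires of type `Y`. Wires carry a bit or an element of `𝔽_q`. The wiring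
constructors (`id`, `comp`, `const`, `fst`, `snd`, `pair`, `proj`, `tuple`) only route wires and
hard-wire advice; indices into bundles are static. When the bit length of `q` is polynomial in the
security parameter, each gate is a Boolean circuit of polynomial size. -/
inductive Circ (q : ℕ) : Type → Type → Type 1
  | id {X : Type} : Circ q X X
  | comp {X Y Z : Type} (f : Circ q X Y) (g : Circ q Y Z) : Circ q X Z
  | const {X Y : Type} (y : Y) : Circ q X Y
  | fst {X Y : Type} : Circ q (X × Y) X
  | snd {X Y : Type} : Circ q (X × Y) Y
  | pair {X Y Z : Type} (f : Circ q X Y) (g : Circ q X Z) : Circ q X (Y × Z)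
  | proj {I X : Type} (i : I) : Circ q (I → X) X
  | tuple {I X Y : Type} [Fintype I] (f : I → Circ q X Y) : Circ q X (I → Y)
  | nand : Circ q (Bool × Bool) Bool
  | add : Circ q (ZMod q × ZMod q) (ZMod q)
  | mul : Circ q (ZMod q × ZMod q) (ZMod q)
  | bit (i : ℕ) : Circ q (ZMod q) Bool
  | ofBit : Circ q Bool (ZMod q)

/-- The function that a circuit computes. -/
def Circ.eval {q : ℕ} : {X Y : Type} → Circ q X Y → X → Y
  | _, _, .id => fun x => x
  | _, _, .comp f g => fun x => g.eval (f.eval x)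
  | _, _, .const y => fun _ => y
  | _, _, .fst => fun x => x.1
  | _, _, .snd => fun x => x.2
  | _, _, .pair f g => fun x => (f.eval x, g.eval x)
  | _, _, .proj i => fun x => x i
  | _, _, @Circ.tuple _ _ _ _ _ f => fun x i => (f i).eval x
  | _, _, .nand => fun x => !(x.1 && x.2)
  | _, _, .add => fun x => x.1 + x.2
  | _, _, .mul => fun x => x.1 * x.2
  | _, _, .bit i => fun x => x.val.testBit i
  | _, _, .ofBit => fun b => if b then 1 else 0

/-- The number of gates of a circuit. -/
def Circ.size {q : ℕ} : {X Y : Type} → Circ q X Y → ℕ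
  | _, _, .id => 0
  | _, _, .comp f g => f.size + g.size
  | _, _, .const _ => 0
  | _, _, .fst => 0
  | _, _, .snd => 0
  | _, _, .pair f g => f.size + g.size
  | _, _, .proj _ => 0
  | _, _, @Circ.tuple _ _ _ _ _ f => ∑ i, (f i).size
  | _, _, .nand => 1
  | _, _, .add => 1
  | _, _, .mul => 1
  | _, _, .bit _ => 1
  | _, _, .ofBit => 1

/-- `s` is bounded by a polynomial for all large security parameters. -/
def PolyBounded (s : ℕ → ℕ) : Prop := ∃ P : Polynomial ℕ, ∀ᶠ lam in atTop, s lam ≤ P.eval lam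

/-- Negligible functions of the security parameter. -/
def Negligible (ν : ℕ → ℝ) : Prop :=
  Asymptotics.SuperpolynomialDecay atTop (fun lam : ℕ => (lam : ℝ)) ν

/-- A random tape of `nb` uniform bits and `nf` uniform elements of `𝔽_q`. -/
abbrev Coins (q nb nf : ℕ) : Type := BitStr nb × (Fin nf → ZMod q)

/-- `|Pr[D(X) = 1] - Pr[D(Y) = 1]|`. -/
noncomputable def advantage {q : ℕ} {T : Type} (D : Circ q T Bool) (X Y : PMF T) : ℝ :=
  |((X.map D.eval) true).toReal - ((Y.map D.eval) true).toReal|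

/-- No family of distinguishers of polynomial size has an advantage that exceeds `ε` by more than a
negligible amount. (The distinguishers may depend on the security parameter in any way, so that
giving them coins as well would not make them stronger.) -/
def IndistUpTo (p : ℕ → ℕ) (ε : ℕ → ℝ) {T : ℕ → Type} (X Y : ∀ lam, PMF (T lam)) : Prop :=
  ∀ D : ∀ lam, Circ (p lam) (T lam) Bool, PolyBounded (fun lam => (D lam).size) →
    ∃ ν : ℕ → ℝ, Negligible ν ∧ ∀ lam, advantage (D lam) (X lam) (Y lam) ≤ ν lam + ε lam

/-- Computational indistinguishability. -/
def Indist (p : ℕ → ℕ) {T : ℕ → Type} (X Y : ∀ lam, PMF (T lam)) : Prop :=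
  IndistUpTo p (fun _ => 0) X Y

/-! ## Boolean circuits and garbling schemes -/

/-- A Boolean gate reading two (or one) of `w` existing wires. -/
inductive BGate (w : ℕ) : Type
  | and (a b : Fin w)
  | xor (a b : Fin w)
  | not (a : Fin w)

/-- A sequence of gates on `n` input wires, with `w` wires altogether. -/
inductive BWires (n : ℕ) : ℕ → Type
  | inputs : BWires n n
  | snoc {w : ℕ} (c : BWires n w) (g : BGate w) : BWires n (w + 1)

/-- A Boolean circuit with `n` inputs and `m` outputs. -/
structure BoolCircuit (n m : ℕ) where
  wires : ℕ
  body : BWires n wires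
  out : Fin m → Fin wires

def BGate.eval {w : ℕ} (v : BitStr w) : BGate w → Bool
  | .and a b => v a && v b
  | .xor a b => Bool.xor (v a) (v b)
  | .not a => !(v a)

def BWires.eval {n : ℕ} (x : BitStr n) : {w : ℕ} → BWires n w → BitStr w
  | _, .inputs => x
  | _, .snoc c g => Fin.snoc (α := fun _ => Bool) (c.eval x) (g.eval (c.eval x))

def BoolCircuit.eval {n m : ℕ} (C : BoolCircuit n m) (x : BitStr n) : BitStr m :=
  fun i => C.body.eval x (C.out i)

/-- The number of wires (inputs and gates). -/
def BoolCircuit.size {n m : ℕ} (C : BoolCircuit n m) : ℕ := C.wires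

/-- A label of `λ ≥ 1` bits, written as `ξ ‖ ζ` with `ξ ∈ {0,1}` and `ζ ∈ {0,1}^(λ-1)`. -/
abbrev Label (lam : ℕ) : Type := Bool × BitStr (lam - 1)

/-- The output of `Garble`: the garbled circuit (a string of `l` bits) and the two labels of every
input wire and of every output wire. -/
structure Garbled (lam n m l : ℕ) where
  gc : BitStr l
  labIn : Fin n → Bool → Label lam
  labOut : Fin m → Bool → Label lam

/-- The syntax of a garbling scheme: the randomized algorithm `Garble` and the deterministic
algorithm `GCEval`. The circuit is public. -/
structure GarblingScheme where
  gcLen : (lam : ℕ) → {n m : ℕ} → BoolCircuit n m → ℕ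
  garble : (lam : ℕ) → {n m : ℕ} → (C : BoolCircuit n m) → PMF (Garbled lam n m (gcLen lam C))
  gcEval : (lam : ℕ) → {n m : ℕ} → (C : BoolCircuit n m) →
    BitStr (gcLen lam C) → (Fin n → Label lam) → (Fin m → Label lam)

/-- The garbled input `{lab^in_{i,x[i]}}` of `x`. -/
def Garbled.input {lam n m l : ℕ} (g : Garbled lam n m l) (x : BitStr n) : Fin n → Label lam :=
  fun i => g.labIn i (x i)

namespace GarblingScheme

/-- Families of circuits with polynomially many inputs, outputs and gates. -/
def PolyFamily {n m : ℕ → ℕ} (C : ∀ lam, BoolCircuit (n lam) (m lam)) : Prop :=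
  PolyBounded n ∧ PolyBounded m ∧ PolyBounded (fun lam => (C lam).size)

/-- `GCEval` runs in polynomial time on circuits of polynomial size. -/
def Efficient (G : GarblingScheme) (p : ℕ → ℕ) : Prop :=
  ∀ (n m : ℕ → ℕ) (C : ∀ lam, BoolCircuit (n lam) (m lam)), PolyFamily C →
    ∃ E : ∀ lam, Circ (p lam) (BitStr (G.gcLen lam (C lam)) × (Fin (n lam) → Label lam))
        (Fin (m lam) → Label lam),
      PolyBounded (fun lam => (E lam).size) ∧
        ∀ lam gc labs, (E lam).eval (gc, labs) = G.gcEval lam (C lam) gc labs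

/-- Correctness: evaluation on the garbled input of `x` gives the output labels of `C(x)`. -/
def Correct (G : GarblingScheme) : Prop :=
  ∀ (lam n m : ℕ) (C : BoolCircuit n m) (x : BitStr n), ∀ g ∈ (G.garble lam C).support,
    G.gcEval lam C g.gc (g.input x) = fun i => g.labOut i (C.eval x i)

/-- Point-and-permute: the two labels of an output wire differ in their first bit. -/
def PointAndPermute (G : GarblingScheme) : Prop :=
  ∀ (lam n m : ℕ) (C : BoolCircuit n m), ∀ g ∈ (G.garble lam C).support,
    ∀ i, (g.labOut i true).1 = !(g.labOut i false).1

/-- What the evaluator of a garbled circuit sees: the garbled circuit and the garbled input. -/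
noncomputable def evalView (G : GarblingScheme) (lam : ℕ) {n m : ℕ} (C : BoolCircuit n m)
    (x : BitStr n) : PMF (BitStr (G.gcLen lam C) × (Fin n → Label lam)) :=
  (G.garble lam C).map fun g => (g.gc, g.input x)

/-- Security: a polynomial-size probabilistic simulator that does not know the input `x` produces
a garbled circuit and a garbled input that are indistinguishable from the real ones. -/
def Secure (G : GarblingScheme) (p : ℕ → ℕ) [∀ lam, Fact (p lam).Prime] : Prop :=
  ∀ (n m : ℕ → ℕ) (C : ∀ lam, BoolCircuit (n lam) (m lam)), PolyFamily C →
    ∃ (nb nf : ℕ → ℕ)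
      (S : ∀ lam, Circ (p lam) (Coins (p lam) (nb lam) (nf lam))
        (BitStr (G.gcLen lam (C lam)) × (Fin (n lam) → Label lam))),
      PolyBounded (fun lam => (S lam).size) ∧
        ∀ x : ∀ lam, BitStr (n lam),
          Indist p (fun lam => G.evalView lam (C lam) (x lam))
            (fun lam => (unif (Coins (p lam) (nb lam) (nf lam))).map (S lam).eval)

/-- The view of the evaluator on input `x`, with the output labels of the complement of `C(x)`. -/
noncomputable def otherReal (G : GarblingScheme) (lam : ℕ) {n m : ℕ} (C : BoolCircuit n m)
    (x : BitStr n) :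
    PMF ((BitStr (G.gcLen lam C) × (Fin n → Label lam)) × (Fin m → Label lam)) :=
  (G.garble lam C).map fun g => ((g.gc, g.input x), fun i => g.labOut i (!(C.eval x i)))

/-- The view of the evaluator on input `x`, with labels that are uniform up to their first bit,
which is the complement of the first bit of the label of `C(x)[i]`. -/
noncomputable def otherUniform (G : GarblingScheme) (lam : ℕ) {n m : ℕ} (C : BoolCircuit n m)
    (x : BitStr n) :
    PMF ((BitStr (G.gcLen lam C) × (Fin n → Label lam)) × (Fin m → Label lam)) := do
  let g ← G.garble lam C
  let r ← unif (Fin m → BitStr (lam - 1))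
  pure ((g.gc, g.input x), fun i => (!(g.labOut i (C.eval x i)).1, r i))

/-- Authenticity: given the garbled circuit and the garbled input of `x`, the output labels of the
complement of `C(x)` are indistinguishable from uniform ones. -/
def Authentic (G : GarblingScheme) (p : ℕ → ℕ) : Prop :=
  ∀ (n m : ℕ → ℕ) (C : ∀ lam, BoolCircuit (n lam) (m lam)), PolyFamily C →
    ∀ x : ∀ lam, BitStr (n lam),
      Indist p (fun lam => G.otherReal lam (C lam) (x lam))
        (fun lam => G.otherUniform lam (C lam) (x lam))

end GarblingScheme

/-- `C` computes the bits of `u` and of `sign(u)` from (the bits of) the two shares of `u`. -/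
def ComputesSign (q : ℕ) (C : BoolCircuit (kappa q + kappa q) (kappa q + kappa q)) : Prop :=
  ∀ x0 x1 : BitStr (kappa q),
    C.eval (Fin.append x0 x1) =
      Fin.append (bitsOf (ofBits q x0 + ofBits q x1)) (bitsOf (sgn (ofBits q x0 + ofBits q x1)))

/-! ## The protocol

`S_0` is the honest server, with input `⟨u⟩₀` and a uniform MAC key `α`; the client `S_1` is
corrupted. Oblivious transfer and the generation of authenticated triples are ideal
functionalities. -/

/-- What the client receives in the garbled circuit phase (`S_1` gets the labels of its own input
bits by oblivious transfer and those of `S_0` directly, then the garbled circuit) and in the first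
authentication phase (the ciphertexts `ct_{i,s}` and `ĉt_{i,s}` for `s ∈ {0,1}`). -/
abbrev Msg1 (q lam l : ℕ) : Type :=
  (BitStr l × (Fin (kappa q + kappa q) → Label lam)) ×
    (Fin (kappa q) → Bool → BitStr (kappa q)) ×
    (Fin (kappa q) → Bool → BitStr (kappa q + kappa q))

/-- What the client receives in the second authentication phase: its shares
`⟨αA⟩₁, ⟨αB⟩₁, ⟨C⟩₁, ⟨αC⟩₁` of the triple and the shares `⟨Γ⟩₀, ⟨Λ⟩₀` of the opened values. -/
abbrev Msg2 (q : ℕ) : Type :=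
  (ZMod q × ZMod q × ZMod q × ZMod q) × (ZMod q × ZMod q)

/-- The last message of the client: a bit that is `false` if the client aborts, and authenticated
shares `(⟨Γ⟩₁, ⟨αΓ⟩₁)` and `(⟨Λ⟩₁, ⟨αΛ⟩₁)` of the opened values. -/
abbrev Opening (q : ℕ) : Type := Bool × (ZMod q × ZMod q) × (ZMod q × ZMod q)

/-- The output of `S_0`: `(true, ⟨αu⟩₀, ⟨f(u)⟩₀, ⟨αf(u)⟩₀)`, or `(false, 0, 0, 0)` on abort. -/
abbrev ServerOut (q : ℕ) : Type := Bool × ZMod q × ZMod q × ZMod q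

/-- The random masks `τ_{i,0}, ρ_{i,0}, σ_{i,0}` of `S_0`. -/
structure Masks (q : ℕ) where
  tau : Fin (kappa q) → ZMod q
  rho : Fin (kappa q) → ZMod q
  sigma : Fin (kappa q) → ZMod q

/-- The bit `j` as a field element. -/
def bitVal (q : ℕ) (j : Bool) : ZMod q := if j then 1 else 0

/-- `ct_{i,s}`. The slot `s = ξ_{i,j}` holds `τ_{i,j} ⊕ Trun_κ(ζ_{i,j})`, where
`τ_{i,j} = τ_{i,0} + j α`; the `j` with `ξ_{i,j} = s` is `s ⊕ ξ_{i,0}`, since `ξ_{i,1} ≠ ξ_{i,0}`. -/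
def ctU {q lam l : ℕ} (g : Garbled lam (kappa q + kappa q) (kappa q + kappa q) l) (α : ZMod q)
    (M : Masks q) (i : Fin (kappa q)) (s : Bool) : BitStr (kappa q) :=
  let lab := g.labOut (Fin.castAdd (kappa q) i)
  let j := xor s (lab false).1
  bxor (bitsOf (M.tau i + bitVal q j * α)) (trun (kappa q) (lab j).2)

/-- `ĉt_{i,s}`. The slot `s = ξ_{i+κ,j}` holds `(ρ_{i,j} ‖ σ_{i,j}) ⊕ Trun_{2κ}(ζ_{i+κ,j})`, where
`ρ_{i,j} = ρ_{i,0} + j` and `σ_{i,j} = σ_{i,0} + j α`. -/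
def ctSign {q lam l : ℕ} (g : Garbled lam (kappa q + kappa q) (kappa q + kappa q) l) (α : ZMod q)
    (M : Masks q) (i : Fin (kappa q)) (s : Bool) : BitStr (kappa q + kappa q) :=
  let lab := g.labOut (Fin.natAdd (kappa q) i)
  let j := xor s (lab false).1
  bxor (Fin.append (bitsOf (M.rho i + bitVal q j)) (bitsOf (M.sigma i + bitVal q j * α)))
    (trun (kappa q + kappa q) (lab j).2)

/-- The first messages of `S_0` to a client that uses the bits `x1` in the oblivious transfers. -/
def serverMsg1 {q lam l : ℕ} (g : Garbled lam (kappa q + kappa q) (kappa q + kappa q) l)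
    (u0 α : ZMod q) (M : Masks q) (x1 : BitStr (kappa q)) : Msg1 q lam l :=
  ((g.gc, g.input (Fin.append (bitsOf u0) x1)), ctU g α M, ctSign g α M)

/-- The shares of `S_0` of `g₁ = αu`, `g₂ = sign(u)`, `g₃ = α sign(u)` (local computation phase). -/
def share1 {q : ℕ} (M : Masks q) : ZMod q := -weighted M.tau

def share2 {q : ℕ} (M : Masks q) : ZMod q := -weighted M.rho

def share3 {q : ℕ} (M : Masks q) : ZMod q := -weighted M.sigma

/-- The shares of `S_0` of an authenticated multiplication triple. -/
structure TripleShare (q : ℕ) where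
  A : ZMod q
  B : ZMod q
  C : ZMod q
  aA : ZMod q
  aB : ZMod q
  aC : ZMod q

/-- Generation of an authenticated triple `A B = C` under the MAC key `α`: the client contributes
`⟨A⟩₁, ⟨B⟩₁` (of its own choice if it is corrupted), all shares of `S_0` are uniform, and the client
obtains `⟨αA⟩₁, ⟨αB⟩₁, ⟨C⟩₁, ⟨αC⟩₁`. -/
noncomputable def tripleGen {q : ℕ} [Fact q.Prime] (α A1 B1 : ZMod q) :
    PMF (TripleShare q × (ZMod q × ZMod q × ZMod q × ZMod q)) := do
  let A0 ← unif (ZMod q)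
  let B0 ← unif (ZMod q)
  let C0 ← unif (ZMod q)
  let aA0 ← unif (ZMod q)
  let aB0 ← unif (ZMod q)
  let aC0 ← unif (ZMod q)
  let A := A0 + A1
  let B := B0 + B1
  pure (⟨A0, B0, C0, aA0, aB0, aC0⟩, (α * A - aA0, α * B - aB0, A * B - C0, α * (A * B) - aC0))

/-- The shares `⟨Γ⟩₀ = ⟨u⟩₀ - ⟨A⟩₀` and `⟨Λ⟩₀ = ⟨g₂⟩₀ - ⟨B⟩₀` that `S_0` reveals. -/
def serverOpen {q : ℕ} (u0 : ZMod q) (M : Masks q) (t : TripleShare q) : ZMod q × ZMod q :=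
  (u0 - t.A, share2 M - t.B)

/-- The end of the protocol for `S_0`. It reconstructs `Γ` and `Λ` and authenticates them: their
MACs, reconstructed from `⟨αΓ⟩ = ⟨g₁⟩ - ⟨αA⟩` and `⟨αΛ⟩ = ⟨g₃⟩ - ⟨αB⟩`, have to be `αΓ` and `αΛ`;
otherwise it aborts. It then outputs `⟨g₁⟩₀` and its shares
`⟨z₂⟩₀ = ⟨C⟩₀ + Γ⟨B⟩₀ + Λ⟨A⟩₀ + ΓΛ` and `⟨z₃⟩₀ = ⟨αC⟩₀ + Γ⟨αB⟩₀ + Λ⟨αA⟩₀ + αΓΛ`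
of `f(u)` and `αf(u)` (the public products are added by `S_0` only). -/
def serverFinish {q : ℕ} (u0 α : ZMod q) (M : Masks q) (t : TripleShare q) (o : Opening q) :
    ServerOut q :=
  let Γ := (serverOpen u0 M t).1 + o.2.1.1
  let Λ := (serverOpen u0 M t).2 + o.2.2.1
  if o.1 = true ∧ (share1 M - t.aA) + o.2.1.2 = α * Γ ∧ (share3 M - t.aB) + o.2.2.2 = α * Λ then
    (true, share1 M, t.C + Γ * t.B + Λ * t.A + Γ * Λ, t.aC + Γ * t.aB + Λ * t.aA + α * (Γ * Λ))
  else (false, 0, 0, 0)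

/-! ## Real and ideal executions -/

/-- The length of the garbled circuit in the protocol. -/
abbrev protoLen (G : GarblingScheme) {p : ℕ → ℕ}
    (booln : ∀ lam, BoolCircuit (kappa (p lam) + kappa (p lam)) (kappa (p lam) + kappa (p lam)))
    (lam : ℕ) : ℕ := G.gcLen lam (booln lam)

/-- A malicious client: arbitrary probabilistic circuits that choose the bits used in the oblivious
transfers, then the shares `⟨A⟩₁, ⟨B⟩₁`, then the opening, each from the coins and all the messages
received so far. (The shares `⟨Γ⟩₀, ⟨Λ⟩₀` are seen before the opening is chosen.) -/
structure Adversary (p : ℕ → ℕ) (len : ℕ → ℕ) where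
  nb : ℕ → ℕ
  nf : ℕ → ℕ
  choose1 : ∀ lam, Circ (p lam) (Coins (p lam) (nb lam) (nf lam)) (BitStr (kappa (p lam)))
  choose2 : ∀ lam, Circ (p lam)
    (Coins (p lam) (nb lam) (nf lam) × Msg1 (p lam) lam (len lam)) (ZMod (p lam) × ZMod (p lam))
  choose3 : ∀ lam, Circ (p lam)
    (Coins (p lam) (nb lam) (nf lam) × Msg1 (p lam) lam (len lam) × Msg2 (p lam))
    (Opening (p lam))

def Adversary.PolySize {p len : ℕ → ℕ} (Adv : Adversary p len) : Prop :=
  PolyBounded (fun lam => (Adv.choose1 lam).size) ∧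
    PolyBounded (fun lam => (Adv.choose2 lam).size) ∧
    PolyBounded (fun lam => (Adv.choose3 lam).size)

/-- The view of the client: its coins and all the messages it receives. -/
abbrev Adversary.View {p len : ℕ → ℕ} (Adv : Adversary p len) (lam : ℕ) : Type :=
  Coins (p lam) (Adv.nb lam) (Adv.nf lam) × Msg1 (p lam) lam (len lam) × Msg2 (p lam)

/-- The real execution with the input `u0` of `S_0`: the MAC key, the output of `S_0` and the view
of the client. -/
noncomputable def realExec {p : ℕ → ℕ} [∀ lam, Fact (p lam).Prime] (G : GarblingScheme)
    (booln : ∀ lam, BoolCircuit (kappa (p lam) + kappa (p lam)) (kappa (p lam) + kappa (p lam)))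
    (Adv : Adversary p (protoLen G booln)) (lam : ℕ) (u0 : ZMod (p lam)) :
    PMF (ZMod (p lam) × ServerOut (p lam) × Adv.View lam) := do
  let α ← unif (ZMod (p lam))
  let r ← unif (Coins (p lam) (Adv.nb lam) (Adv.nf lam))
  let x1 := (Adv.choose1 lam).eval r
  let g ← G.garble lam (booln lam)
  let tau ← unif (Fin (kappa (p lam)) → ZMod (p lam))
  let rho ← unif (Fin (kappa (p lam)) → ZMod (p lam))
  let sigma ← unif (Fin (kappa (p lam)) → ZMod (p lam))
  let M : Masks (p lam) := ⟨tau, rho, sigma⟩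
  let m1 := serverMsg1 g u0 α M x1
  let ab := (Adv.choose2 lam).eval (r, m1)
  let t ← tripleGen α ab.1 ab.2
  let m2 := (t.2, serverOpen u0 M t.1)
  let o := (Adv.choose3 lam).eval (r, m1, m2)
  pure (α, serverFinish u0 α M t.1 o, (r, m1, m2))

/-- A simulator: from its coins it chooses the input `⟨u⟩₁` of the client for the ideal
functionality; from its coins and the client's shares that the functionality returns it computes
a view, and a bit that tells the functionality whether `S_0` receives its output or aborts. -/
structure Simulator (p : ℕ → ℕ) (View : ℕ → Type) where
  nb : ℕ → ℕ
  nf : ℕ → ℕ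
  input : ∀ lam, Circ (p lam) (Coins (p lam) (nb lam) (nf lam)) (ZMod (p lam))
  simulate : ∀ lam, Circ (p lam)
    (Coins (p lam) (nb lam) (nf lam) × (ZMod (p lam) × ZMod (p lam) × ZMod (p lam)))
    (Bool × View lam)

def Simulator.PolySize {p : ℕ → ℕ} {View : ℕ → Type} (S : Simulator p View) : Prop :=
  PolyBounded (fun lam => (S.input lam).size) ∧ PolyBounded (fun lam => (S.simulate lam).size)

/-- The ideal functionality: uniform additive shares of `αu`, `f(u)`, `αf(u)` for `f = ReLU`. The
first component is given to `S_0`, the second to `S_1`. -/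
noncomputable def idealFun {q : ℕ} [Fact q.Prime] (u0 α u1 : ZMod q) :
    PMF ((ZMod q × ZMod q × ZMod q) × (ZMod q × ZMod q × ZMod q)) := do
  let k1 ← unif (ZMod q)
  let t1 ← unif (ZMod q)
  let d1 ← unif (ZMod q)
  let u := u0 + u1
  pure ((α * u - k1, relu u - t1, α * relu u - d1), (k1, t1, d1))

/-- The ideal execution with the input `u0` of `S_0`. -/
noncomputable def idealExec {p : ℕ → ℕ} [∀ lam, Fact (p lam).Prime] {View : ℕ → Type}
    (S : Simulator p View) (lam : ℕ) (u0 : ZMod (p lam)) :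
    PMF (ZMod (p lam) × ServerOut (p lam) × View lam) := do
  let α ← unif (ZMod (p lam))
  let r ← unif (Coins (p lam) (S.nb lam) (S.nf lam))
  let w ← idealFun u0 α ((S.input lam).eval r)
  let v := (S.simulate lam).eval (r, w.2)
  pure (α, (if v.1 = true then (true, w.1) else (false, 0, 0, 0)), v.2)

/-- Security against a malicious client. For every adversary there is a simulator such that, for
every input of `S_0`, the view of the client is computationally indistinguishable from the simulated
one, and the view jointly with the output of `S_0` is indistinguishable from its ideal counterpart
up to the statistical error `2^(-⌊log₂ p⌋)` of authenticated shares. The distinguisher is given the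
MAC key in addition. (The view, hence the first claim, does not depend on whether `S_0` authenticates
the opened values, since `S_0` sends nothing afterwards.) -/
def SecureAgainstMaliciousClient (p : ℕ → ℕ) [∀ lam, Fact (p lam).Prime] (G : GarblingScheme)
    (booln : ∀ lam, BoolCircuit (kappa (p lam) + kappa (p lam)) (kappa (p lam) + kappa (p lam))) :
    Prop :=
  ∀ Adv : Adversary p (protoLen G booln), Adv.PolySize →
    ∃ S : Simulator p Adv.View, S.PolySize ∧
      ∀ u0 : ∀ lam, ZMod (p lam),
        Indist p
          (fun lam => (realExec G booln Adv lam (u0 lam)).map fun e => (e.1, e.2.2))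
          (fun lam => (idealExec S lam (u0 lam)).map fun e => (e.1, e.2.2)) ∧
        IndistUpTo p (fun lam => (1 / 2 : ℝ) ^ Nat.log 2 (p lam))
          (fun lam => realExec G booln Adv lam (u0 lam))
          (fun lam => idealExec S lam (u0 lam))

end NonLin

namespace NonLin

/-! ## Uniform distributions -/

/-! After two computational steps the execution is a function of uniform variables in which the
client's view depends neither on `α` nor on `⟨u⟩₀`. Only the final decision and output of `S_0`
still do, and there the two executions differ only if the client forges a MAC.

Fix all random choices except the garbling. By correctness and point-and-permute, the first message
is determined by what the evaluator sees, the values `(c, d, e)` that it decrypts, and the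
ciphertexts that it cannot open (`serverMsg1_eq`, `realExec_eq`). Authenticity makes the keys of the
latter uniform, and since `2κ ≤ λ - 1` they are one-time pads (`unif_map_encrypted`). Security then
replaces the garbled circuit by a simulated one. Both steps are averaging arguments: a non-uniform
distinguisher can hard-wire the best choice of everything else (`Indist.bind_map`), which is why
`EffFam` bounds circuit sizes uniformly over a parameter.

Next, for fixed `α` and `⟨u⟩₀`, the masks and triple shares of `S_0` are replaced by the values that
the client receives. This substitution is bijective (`ClientRnd.toExec_injective`), so these values
are uniform and independent of `α` (`simExec_eq`). In the new coordinates the test of `S_0` says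
that the client's deviation in each MAC share is `α` times its deviation in the corresponding value
(`openingOk_iff`). An honest opening passes, and Beaver's identity gives complementary output shares
(`finalShares_eq`). Any other opening passes for at most one `α` (`ClientRnd.eq_of_realOut_ne`),
hence with probability at most `1/p ≤ 2^(-⌊log₂ p⌋)`.

The simulator samples the new coordinates, extracts `⟨u⟩₁` from the bits used in the oblivious
transfers, and lets `S_0` abort exactly if the opening is not honest, a condition that involves
neither `α` nor `⟨u⟩₀`. To agree with the shares handed out by the functionality it corrects the
first entry of `c` and solves for `⟨C⟩₁, ⟨αC⟩₁`; this keeps all coordinates uniform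
(`SimRnd.unif_bind_complete`). Once the output of `S_0` is dropped, the simulated-garbling execution
and the ideal one coincide, so the first claim has no statistical error. -/

theorem pmf_bind_eq {A B : Type} (μ : PMF A) (f : A → PMF B) : (μ >>= f) = μ.bind f := rfl

theorem pmf_pure_eq {A : Type} (a : A) : (pure a : PMF A) = PMF.pure a := rfl

section Uniform

variable {A B E : Type} [Fintype A] [Nonempty A] [Fintype B] [Nonempty B]

theorem unif_apply (a : A) : unif A a = (Fintype.card A : ENNReal)⁻¹ := by
  simp [unif]

/-- Collecting successive independent draws into one uniform draw makes bijections of the whole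
sample space applicable. -/
theorem unif_bind_prod (f : A → B → PMF E) :
    ((unif A).bind fun a => (unif B).bind fun b => f a b) =
      (unif (A × B)).bind fun x => f x.1 x.2 := by
  ext e
  simp only [PMF.bind_apply, unif_apply, tsum_fintype, Fintype.sum_prod_type, Fintype.card_prod,
    Finset.mul_sum]
  refine Finset.sum_congr rfl fun a _ => Finset.sum_congr rfl fun b _ => ?_
  rw [← mul_assoc, Nat.cast_mul, ENNReal.mul_inv (by simp) (by simp)]

theorem unif_map_of_bijective {f : A → B} (hf : Function.Bijective f) :
    (unif A).map f = unif B := by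
  classical
  ext b
  obtain ⟨a, rfl⟩ := hf.2 b
  rw [PMF.map_apply, tsum_eq_single a]
  · simp [unif_apply, Fintype.card_of_bijective hf]
  · intro a' h
    rw [if_neg]
    exact fun h' => h (hf.1 h'.symm)

/-- Change of variables; used for the client's coordinates, for the simulator's coordinates and for
reading random tapes. -/
theorem unif_bind_of_bijective {f : A → B} (hf : Function.Bijective f) (F : B → PMF E) :
    ((unif A).bind fun a => F (f a)) = (unif B).bind F := by
  rw [← unif_map_of_bijective hf, PMF.bind_map]
  rfl

/-- A distribution that is invariant under a transitive set of permutations is uniform. -/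
theorem eq_unif_of_transitive (μ : PMF B)
    (h : ∀ b b' : B, ∃ ρ : B → B, Function.Injective ρ ∧ ρ b = b' ∧ μ.map ρ = μ) :
    μ = unif B := by
  classical
  have key : ∀ b b', μ b' = μ b := by
    intro b b'
    obtain ⟨ρ, hρ, rfl, hμ⟩ := h b b'
    conv_lhs => rw [← hμ]
    rw [PMF.map_apply, tsum_eq_single b]
    · simp
    · intro a' h
      rw [if_neg]
      exact fun h' => h (hρ h'.symm)
  ext b
  have h1 : ∑ b', μ b' = 1 := by rw [← tsum_fintype (L := SummationFilter.unconditional _)]; exact μ.tsum_coe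
  rw [Finset.sum_congr rfl fun b' _ => key b b'] at h1
  simp only [Finset.sum_const, Finset.card_univ, nsmul_eq_mul] at h1
  rw [unif_apply]
  exact ENNReal.eq_inv_of_mul_eq_one_left (by rwa [mul_comm] at h1)

/-- If `f` intertwines, for a transitive set of permutations of its target, with permutations of
its source, then it maps the uniform distribution to the uniform one. -/
theorem unif_map_of_equivariant (f : A → B)
    (h : ∀ b b' : B, ∃ (ρ : B → B) (σ : A → A), Function.Injective ρ ∧ Function.Injective σ ∧
      ρ b = b' ∧ ∀ a, ρ (f a) = f (σ a)) :
    (unif A).map f = unif B := by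
  refine eq_unif_of_transitive _ fun b b' => ?_
  obtain ⟨ρ, σ, hρ, hσ, hb, hc⟩ := h b b'
  refine ⟨ρ, hρ, hb, ?_⟩
  conv_rhs => rw [← unif_map_of_bijective (Finite.injective_iff_bijective.1 hσ), PMF.map_comp]
  rw [PMF.map_comp]
  congr 1
  funext a
  exact hc a

theorem unif_bind_fst (F : A → PMF E) :
    ((unif (A × B)).bind fun x => F x.1) = (unif A).bind F := by
  rw [← unif_bind_prod (fun a (_ : B) => F a)]
  simp

theorem unif_bind_of_map {f : A → B} (hf : (unif A).map f = unif B) (F : B → PMF E) :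
    ((unif A).bind fun a => F (f a)) = (unif B).bind F := by
  rw [← hf, PMF.bind_map]
  rfl

end Uniform

/-! ## Distinguishing advantages -/

/-- `Pr[D(X) = 1]`. -/
noncomputable def accept {T : Type} (D : T → Bool) (X : PMF T) : ℝ := ((X.map D) true).toReal

theorem accept_nonneg {T : Type} (D : T → Bool) (X : PMF T) : 0 ≤ accept D X :=
  ENNReal.toReal_nonneg

theorem accept_le_one {T : Type} (D : T → Bool) (X : PMF T) : accept D X ≤ 1 := by
  refine ENNReal.toReal_le_of_le_ofReal zero_le_one ?_
  rw [ENNReal.ofReal_one]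
  exact PMF.coe_le_one _ _

theorem accept_map {T T' : Type} (D : T' → Bool) (F : T → T') (X : PMF T) :
    accept D (X.map F) = accept (D ∘ F) X := by
  rw [accept, accept, PMF.map_comp]

theorem accept_unif_bind {W T : Type} [Fintype W] [Nonempty W] (D : T → Bool) (X : W → PMF T) :
    accept D ((unif W).bind X) = (∑ w, accept D (X w)) / Fintype.card W := by
  simp only [accept, PMF.map_bind, PMF.bind_apply, tsum_fintype, unif_apply]
  rw [← Finset.mul_sum, ENNReal.toReal_mul, ENNReal.toReal_sum fun w _ => PMF.apply_ne_top _ _]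
  simp [div_eq_inv_mul]

theorem advantage_eq {q : ℕ} {T : Type} (D : Circ q T Bool) (X Y : PMF T) :
    advantage D X Y = |accept D.eval X - accept D.eval Y| := rfl

theorem abs_accept_sub_le_one {T : Type} (D : T → Bool) (X Y : PMF T) :
    |accept D X - accept D Y| ≤ 1 := by
  have := accept_nonneg D X
  have := accept_nonneg D Y
  have := accept_le_one D X
  have := accept_le_one D Y
  rw [abs_le]
  constructor <;> linarith

theorem abs_accept_unif_bind_le {W T : Type} [Fintype W] [Nonempty W] (D : T → Bool)
    (X Y : W → PMF T) {B : ℝ} (h : ∀ w, |accept D (X w) - accept D (Y w)| ≤ B) :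
    |accept D ((unif W).bind X) - accept D ((unif W).bind Y)| ≤ B := by
  have hc : (0 : ℝ) < Fintype.card W := by exact_mod_cast Fintype.card_pos
  rw [accept_unif_bind, accept_unif_bind, ← sub_div, ← Finset.sum_sub_distrib, abs_div,
    abs_of_pos hc, div_le_iff₀ hc]
  refine (Finset.abs_sum_le_sum_abs _ _).trans ?_
  refine (Finset.sum_le_sum fun w _ => h w).trans ?_
  simp [mul_comm]

/-- The gap of two averages is at most the largest gap. The maximizing `w` is the advice that a
non-uniform distinguisher hard-wires. -/
theorem exists_abs_accept_unif_bind_le {W T : Type} [Fintype W] [Nonempty W] (D : T → Bool)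
    (X Y : W → PMF T) :
    ∃ w, |accept D ((unif W).bind X) - accept D ((unif W).bind Y)| ≤
      |accept D (X w) - accept D (Y w)| := by
  obtain ⟨w, hw⟩ := Finite.exists_max fun w => |accept D (X w) - accept D (Y w)|
  exact ⟨w, abs_accept_unif_bind_le D X Y hw⟩

/-- Two functions that differ at one point at most are statistically close on uniform inputs. -/
theorem abs_accept_unif_pure_le {W T : Type} [Fintype W] [Nonempty W] (D : T → Bool)
    (f g : W → T) (h : ∀ a b, f a ≠ g a → f b ≠ g b → a = b) :
    |accept D ((unif W).bind fun w => PMF.pure (f w)) -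
      accept D ((unif W).bind fun w => PMF.pure (g w))| ≤ 1 / Fintype.card W := by
  classical
  have hc : (0 : ℝ) < Fintype.card W := by exact_mod_cast Fintype.card_pos
  rw [accept_unif_bind, accept_unif_bind, ← sub_div, ← Finset.sum_sub_distrib, abs_div,
    abs_of_pos hc]
  gcongr
  refine (Finset.abs_sum_le_sum_abs _ _).trans ?_
  have hb : ∀ w, |accept D (PMF.pure (f w)) - accept D (PMF.pure (g w))| ≤
      if f w ≠ g w then 1 else 0 := by
    intro w
    split_ifs with hw
    · exact abs_accept_sub_le_one _ _ _
    · rw [not_not] at hw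
      simp [hw]
  refine (Finset.sum_le_sum fun w _ => hb w).trans ?_
  rw [Finset.sum_boole]
  have : (Finset.univ.filter fun w => f w ≠ g w).card ≤ 1 := by
    rw [Finset.card_le_one]
    intro a ha b hb
    simp only [Finset.mem_filter, Finset.mem_univ, true_and] at ha hb
    exact h a b ha hb
  exact_mod_cast this

/-! ## Indistinguishability -/

theorem PolyBounded.mono {s t : ℕ → ℕ} (ht : PolyBounded t) (h : ∀ᶠ lam in atTop, s lam ≤ t lam) :
    PolyBounded s := by
  obtain ⟨P, hP⟩ := ht
  exact ⟨P, by filter_upwards [hP, h] with lam h1 h2 using h2.trans h1⟩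

theorem PolyBounded.add {s t : ℕ → ℕ} (hs : PolyBounded s) (ht : PolyBounded t) :
    PolyBounded fun lam => s lam + t lam := by
  obtain ⟨P, hP⟩ := hs
  obtain ⟨Q, hQ⟩ := ht
  refine ⟨P + Q, ?_⟩
  filter_upwards [hP, hQ] with lam h1 h2
  rw [Polynomial.eval_add]
  exact add_le_add h1 h2

theorem PolyBounded.mul {s t : ℕ → ℕ} (hs : PolyBounded s) (ht : PolyBounded t) :
    PolyBounded fun lam => s lam * t lam := by
  obtain ⟨P, hP⟩ := hs
  obtain ⟨Q, hQ⟩ := ht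
  refine ⟨P * Q, ?_⟩
  filter_upwards [hP, hQ] with lam h1 h2
  rw [Polynomial.eval_mul]
  exact Nat.mul_le_mul h1 h2

theorem PolyBounded.const (c : ℕ) : PolyBounded fun _ => c :=
  ⟨Polynomial.C c, by simp⟩

theorem PolyBounded.self : PolyBounded fun lam => lam :=
  ⟨Polynomial.X, by simp⟩

theorem indistUpTo_of_eventually {p : ℕ → ℕ} {ε : ℕ → ℝ} {T : ℕ → Type}
    {X Y : ∀ lam, PMF (T lam)}
    (h : ∀ D : ∀ lam, Circ (p lam) (T lam) Bool, PolyBounded (fun lam => (D lam).size) →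
      ∃ ν : ℕ → ℝ, Negligible ν ∧
        ∀ᶠ lam in atTop, advantage (D lam) (X lam) (Y lam) ≤ ν lam + ε lam) :
    IndistUpTo p ε X Y := by
  intro D hD
  obtain ⟨ν, hν, hle⟩ := h D hD
  -- Where the bound fails, the error is redefined as the excess of the advantage over `ε`. This
  -- changes only finitely many values, which negligibility does not notice.
  classical
  refine ⟨fun lam => if advantage (D lam) (X lam) (Y lam) ≤ ν lam + ε lam then ν lam else
    advantage (D lam) (X lam) (Y lam) - ε lam, ?_, fun lam => ?_⟩
  · refine Asymptotics.SuperpolynomialDecay.congr' hν ?_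
    filter_upwards [hle] with lam h1
    rw [if_pos h1]
  · dsimp only
    split_ifs with h1
    · exact h1
    · simp

theorem IndistUpTo.trans {p : ℕ → ℕ} {ε ε' : ℕ → ℝ} {T : ℕ → Type} {X Y Z : ∀ lam, PMF (T lam)}
    (h1 : IndistUpTo p ε X Y) (h2 : IndistUpTo p ε' Y Z) :
    IndistUpTo p (fun lam => ε lam + ε' lam) X Z := by
  intro D hD
  obtain ⟨ν1, hν1, hle1⟩ := h1 D hD
  obtain ⟨ν2, hν2, hle2⟩ := h2 D hD
  refine ⟨ν1 + ν2, hν1.add hν2, fun lam => ?_⟩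
  have := abs_sub_le (accept (D lam).eval (X lam)) (accept (D lam).eval (Y lam))
    (accept (D lam).eval (Z lam))
  have a := hle1 lam
  have b := hle2 lam
  rw [advantage_eq] at *
  simp only [Pi.add_apply]
  linarith

theorem negligible_zero : Negligible fun _ => 0 :=
  Asymptotics.superpolynomialDecay_zero _ _

/-- Statistical closeness: the bound holds for arbitrary tests, so the size of the distinguisher is
irrelevant and no negligible term is needed. -/
theorem indistUpTo_of_accept_le {p : ℕ → ℕ} {ε : ℕ → ℝ} {T : ℕ → Type} {X Y : ∀ lam, PMF (T lam)}
    (h : ∀ᶠ lam in atTop, ∀ D : T lam → Bool, |accept D (X lam) - accept D (Y lam)| ≤ ε lam) :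
    IndistUpTo p ε X Y :=
  indistUpTo_of_eventually fun D _ => ⟨fun _ => 0, negligible_zero, by
    filter_upwards [h] with lam hl
    rw [zero_add]
    exact hl (D lam).eval⟩

theorem indist_of_eventually_eq {p : ℕ → ℕ} {T : ℕ → Type} {X Y : ∀ lam, PMF (T lam)}
    (h : ∀ᶠ lam in atTop, X lam = Y lam) : Indist p X Y := by
  refine indistUpTo_of_accept_le ?_
  filter_upwards [h] with lam hl D
  simp [hl]

theorem Indist.trans {p : ℕ → ℕ} {T : ℕ → Type} {X Y Z : ∀ lam, PMF (T lam)}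
    (h1 : Indist p X Y) (h2 : Indist p Y Z) : Indist p X Z := by
  have := IndistUpTo.trans h1 h2
  simpa only [Indist, add_zero] using this

theorem Indist.trans_indistUpTo {p : ℕ → ℕ} {ε : ℕ → ℝ} {T : ℕ → Type} {X Y Z : ∀ lam, PMF (T lam)}
    (h1 : Indist p X Y) (h2 : IndistUpTo p ε Y Z) : IndistUpTo p ε X Z := by
  have := IndistUpTo.trans h1 h2
  simpa only [zero_add] using this

/-! ## Efficiently computable families -/

/-- The functions `f lam i` are computed by circuits whose size is bounded, uniformly in `i`, by a
polynomial in `lam`. -/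
def EffFam (p : ℕ → ℕ) {ι X Y : ℕ → Type} (f : ∀ lam, ι lam → X lam → Y lam) : Prop :=
  ∃ s : ℕ → ℕ, PolyBounded s ∧
    ∀ lam i, ∃ c : Circ (p lam) (X lam) (Y lam), c.size ≤ s lam ∧ c.eval = f lam i

/-- The conjunction of `n` bits. -/
theorem exists_circ_forall (q n : ℕ) :
    ∃ c : Circ q (BitStr n) Bool, c.size ≤ 2 * n ∧ c.eval = fun x => decide (∀ j, x j = true) := by
  induction n with
  | zero => exact ⟨.const true, by simp [Circ.size], by funext x; simp [Circ.eval]⟩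
  | succ n ih =>
    obtain ⟨c, hs, he⟩ := ih
    -- A NAND followed by a NAND of its result with itself is a conjunction: two gates for each
    -- additional bit.
    refine ⟨.comp (.comp (.pair (.comp (.tuple fun j : Fin n => .proj j.castSucc) c)
      (.proj (Fin.last n))) .nand) (.comp (.pair .id .id) .nand), ?_, ?_⟩
    · simp only [Circ.size, Finset.sum_const_zero]
      omega
    · funext x
      simp only [Circ.eval, he, Fin.forall_fin_succ']
      by_cases h1 : ∀ j : Fin n, x j.castSucc = true <;> cases h2 : x (Fin.last n) <;> simp [h1]

/-- The sum of `n` field elements. -/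
theorem exists_circ_sum (q n : ℕ) :
    ∃ c : Circ q (Fin n → ZMod q) (ZMod q), c.size ≤ n ∧ c.eval = fun x => ∑ j, x j := by
  induction n with
  | zero => exact ⟨.const 0, by simp [Circ.size], by funext x; simp [Circ.eval]⟩
  | succ n ih =>
    obtain ⟨c, hs, he⟩ := ih
    refine ⟨.comp (.pair (.comp (.tuple fun j : Fin n => .proj j.castSucc) c)
      (.proj (Fin.last n))) .add, ?_, ?_⟩
    · simp only [Circ.size, Finset.sum_const_zero]
      omega
    · funext x
      simp only [Circ.eval, he, Fin.sum_univ_castSucc]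

namespace EffFam

variable {p : ℕ → ℕ} {ι X Y Z : ℕ → Type}

theorem of_circ {ι : ℕ → Type} (c : ∀ lam, Circ (p lam) (X lam) (Y lam))
    (hc : PolyBounded fun lam => (c lam).size) :
    EffFam p (ι := ι) (fun lam _ x => (c lam).eval x) :=
  ⟨_, hc, fun lam _ => ⟨c lam, le_rfl, rfl⟩⟩

/-- The size bound does not depend on the index, so even a non-constructive choice of one index per
`lam` yields a polynomial-size family. -/
theorem exists_circ {f : ∀ lam, ι lam → X lam → Y lam} (hf : EffFam p f) (i : ∀ lam, ι lam) :
    ∃ c : ∀ lam, Circ (p lam) (X lam) (Y lam), PolyBounded (fun lam => (c lam).size) ∧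
      ∀ lam, (c lam).eval = f lam (i lam) := by
  obtain ⟨s, hs, h⟩ := hf
  choose c hc he using h
  exact ⟨fun lam => c lam (i lam), hs.mono (Eventually.of_forall fun lam => hc _ _),
    fun lam => he _ _⟩

theorem reindex {κ : ℕ → Type} {f : ∀ lam, ι lam → X lam → Y lam} (hf : EffFam p f)
    (k : ∀ lam, κ lam → ι lam) : EffFam p (fun lam i x => f lam (k lam i) x) := by
  obtain ⟨s, hs, h⟩ := hf
  exact ⟨s, hs, fun lam i => h lam _⟩

theorem const (y : ∀ lam, ι lam → Y lam) : EffFam p (X := X) (fun lam i _ => y lam i) :=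
  ⟨fun _ => 0, PolyBounded.const 0, fun lam i => ⟨.const (y lam i), le_rfl, rfl⟩⟩

theorem id : EffFam p (ι := ι) (X := X) (fun _ _ x => x) :=
  ⟨fun _ => 0, PolyBounded.const 0, fun _ _ => ⟨.id, le_rfl, rfl⟩⟩

theorem comp {g : ∀ lam, ι lam → Y lam → Z lam} {f : ∀ lam, ι lam → X lam → Y lam}
    (hg : EffFam p g) (hf : EffFam p f) : EffFam p (fun lam i x => g lam i (f lam i x)) := by
  obtain ⟨s, hs, h⟩ := hf
  obtain ⟨t, ht, h'⟩ := hg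
  refine ⟨_, hs.add ht, fun lam i => ?_⟩
  obtain ⟨c, hc, he⟩ := h lam i
  obtain ⟨c', hc', he'⟩ := h' lam i
  refine ⟨.comp c c', add_le_add hc hc', ?_⟩
  funext x
  simp only [Circ.eval, he, he']

theorem pair {f : ∀ lam, ι lam → X lam → Y lam} {g : ∀ lam, ι lam → X lam → Z lam}
    (hf : EffFam p f) (hg : EffFam p g) : EffFam p (fun lam i x => (f lam i x, g lam i x)) := by
  obtain ⟨s, hs, h⟩ := hf
  obtain ⟨t, ht, h'⟩ := hg
  refine ⟨_, hs.add ht, fun lam i => ?_⟩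
  obtain ⟨c, hc, he⟩ := h lam i
  obtain ⟨c', hc', he'⟩ := h' lam i
  refine ⟨.pair c c', add_le_add hc hc', ?_⟩
  funext x
  simp only [Circ.eval, he, he']

theorem fst {f : ∀ lam, ι lam → X lam → Y lam × Z lam} (hf : EffFam p f) :
    EffFam p (fun lam i x => (f lam i x).1) :=
  comp (of_circ (fun _ => .fst) (PolyBounded.const 0)) hf

theorem snd {f : ∀ lam, ι lam → X lam → Y lam × Z lam} (hf : EffFam p f) :
    EffFam p (fun lam i x => (f lam i x).2) :=
  comp (of_circ (fun _ => .snd) (PolyBounded.const 0)) hf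

theorem proj {J : ℕ → Type} {f : ∀ lam, ι lam → X lam → J lam → Y lam} (hf : EffFam p f)
    (j : ∀ lam, ι lam → J lam) : EffFam p (fun lam i x => f lam i x (j lam i)) := by
  have : EffFam p (fun lam i (x : J lam → Y lam) => x (j lam i)) :=
    ⟨fun _ => 0, PolyBounded.const 0, fun lam i => ⟨.proj (j lam i), le_rfl, rfl⟩⟩
  exact comp this hf

/-- The component index becomes part of the parameter, so a bundle is efficient as soon as its
components are, uniformly, and there are polynomially many of them. -/
theorem tuple {J : ℕ → Type} [∀ lam, Fintype (J lam)]
    (hJ : PolyBounded fun lam => Fintype.card (J lam))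
    {f : ∀ lam, ι lam → X lam → J lam → Y lam}
    (hf : EffFam p (fun lam (i : ι lam × J lam) x => f lam i.1 x i.2)) : EffFam p f := by
  obtain ⟨s, hs, h⟩ := hf
  refine ⟨_, hJ.mul hs, fun lam i => ?_⟩
  choose c hc he using fun j => h lam (i, j)
  refine ⟨.tuple c, ?_, ?_⟩
  · simp only [Circ.size]
    refine (Finset.sum_le_sum fun j _ => hc j).trans ?_
    simp
  · funext x j
    simp only [Circ.eval, he]

theorem tupleFin {n : ℕ → ℕ} (hn : PolyBounded n)
    {f : ∀ lam, ι lam → X lam → Fin (n lam) → Y lam}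
    (hf : EffFam p (fun lam (i : ι lam × Fin (n lam)) x => f lam i.1 x i.2)) : EffFam p f :=
  tuple (by simpa using hn) hf

theorem lift {J : ℕ → Type} {f : ∀ lam, ι lam → X lam → Y lam} (hf : EffFam p f) :
    EffFam p (fun lam (i : ι lam × J lam) x => f lam i.1 x) :=
  hf.reindex (κ := fun lam => ι lam × J lam) fun _ i => i.1

theorem projSnd {J : ℕ → Type} {f : ∀ lam, ι lam → X lam → J lam → Y lam} (hf : EffFam p f) :
    EffFam p (fun lam (i : ι lam × J lam) x => f lam i.1 x i.2) :=
  proj (f := fun lam (i : ι lam × J lam) x => f lam i.1 x) hf.lift fun _ i => i.2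

/-! ### Boolean operations -/

theorem nand {f g : ∀ lam, ι lam → X lam → Bool} (hf : EffFam p f) (hg : EffFam p g) :
    EffFam p (fun lam i x => !(f lam i x && g lam i x)) := by
  have h : EffFam p (fun lam (_ : ι lam) (x : Bool × Bool) => !(x.1 && x.2)) :=
    ⟨fun _ => 1, PolyBounded.const 1, fun _ _ => ⟨.nand, le_rfl, rfl⟩⟩
  exact comp (f := fun lam i x => (f lam i x, g lam i x)) h (pair hf hg)

theorem not {f : ∀ lam, ι lam → X lam → Bool} (hf : EffFam p f) :
    EffFam p (fun lam i x => !(f lam i x)) := by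
  simpa using nand hf hf

theorem and {f g : ∀ lam, ι lam → X lam → Bool} (hf : EffFam p f) (hg : EffFam p g) :
    EffFam p (fun lam i x => f lam i x && g lam i x) := by
  simpa using not (nand hf hg)

theorem bcond {b f g : ∀ lam, ι lam → X lam → Bool} (hb : EffFam p b) (hf : EffFam p f)
    (hg : EffFam p g) : EffFam p (fun lam i x => if b lam i x = true then f lam i x else g lam i x) := by
  -- The multiplexer built from NAND gates: `(b ∧ f) ∨ (¬b ∧ g)`.
  convert nand (nand hb hf) (nand (not hb) hg) using 4 with lam i x
  cases b lam i x <;> simp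

theorem xor {f g : ∀ lam, ι lam → X lam → Bool} (hf : EffFam p f) (hg : EffFam p g) :
    EffFam p (fun lam i x => Bool.xor (f lam i x) (g lam i x)) := by
  convert bcond hf (not hg) hg using 4 with lam i x
  cases f lam i x <;> simp

theorem forallFin {n : ℕ → ℕ} (hn : PolyBounded n)
    {f : ∀ lam, ι lam → X lam → Fin (n lam) → Bool} (hf : EffFam p f) :
    EffFam p (fun lam i x => decide (∀ j, f lam i x j = true)) := by
  choose c hc he using fun lam => exists_circ_forall (p lam) (n lam)
  have h := comp (of_circ c (((PolyBounded.const 2).mul hn).mono (Eventually.of_forall hc))) hf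
  simpa only [he] using h

/-! ### Arithmetic -/

theorem add {f g : ∀ lam, ι lam → X lam → ZMod (p lam)} (hf : EffFam p f) (hg : EffFam p g) :
    EffFam p (fun lam i x => f lam i x + g lam i x) := by
  have h : EffFam p (fun lam (_ : ι lam) (x : ZMod (p lam) × ZMod (p lam)) => x.1 + x.2) :=
    ⟨fun _ => 1, PolyBounded.const 1, fun _ _ => ⟨.add, le_rfl, rfl⟩⟩
  exact comp (f := fun lam i x => (f lam i x, g lam i x)) h (pair hf hg)

theorem mul {f g : ∀ lam, ι lam → X lam → ZMod (p lam)} (hf : EffFam p f) (hg : EffFam p g) :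
    EffFam p (fun lam i x => f lam i x * g lam i x) := by
  have h : EffFam p (fun lam (_ : ι lam) (x : ZMod (p lam) × ZMod (p lam)) => x.1 * x.2) :=
    ⟨fun _ => 1, PolyBounded.const 1, fun _ _ => ⟨.mul, le_rfl, rfl⟩⟩
  exact comp (f := fun lam i x => (f lam i x, g lam i x)) h (pair hf hg)

theorem neg {f : ∀ lam, ι lam → X lam → ZMod (p lam)} (hf : EffFam p f) :
    EffFam p (fun lam i x => -f lam i x) := by
  simpa using mul (const fun _ _ => -1) hf

theorem sub {f g : ∀ lam, ι lam → X lam → ZMod (p lam)} (hf : EffFam p f) (hg : EffFam p g) :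
    EffFam p (fun lam i x => f lam i x - g lam i x) := by
  simpa only [sub_eq_add_neg] using add hf (neg hg)

theorem bitVal {b : ∀ lam, ι lam → X lam → Bool} (hb : EffFam p b) :
    EffFam p (fun lam i x => bitVal (p lam) (b lam i x)) :=
  comp (of_circ (fun _ => .ofBit) (PolyBounded.const 1)) hb

theorem zcond {b : ∀ lam, ι lam → X lam → Bool} {f g : ∀ lam, ι lam → X lam → ZMod (p lam)}
    (hb : EffFam p b) (hf : EffFam p f) (hg : EffFam p g) :
    EffFam p (fun lam i x => if b lam i x = true then f lam i x else g lam i x) := by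
  -- Selection by arithmetic: `g + b (f - g)` with `b ∈ {0, 1}`.
  convert add hg (mul (bitVal hb) (sub hf hg)) using 4 with lam i x
  cases b lam i x <;> simp [NonLin.bitVal]

theorem sumFin {n : ℕ → ℕ} (hn : PolyBounded n)
    {f : ∀ lam, ι lam → X lam → Fin (n lam) → ZMod (p lam)} (hf : EffFam p f) :
    EffFam p (fun lam i x => ∑ j, f lam i x j) := by
  choose c hc he using fun lam => exists_circ_sum (p lam) (n lam)
  have h := comp (of_circ c (hn.mono (Eventually.of_forall hc))) hf
  simpa only [he] using h

theorem weighted {n : ℕ → ℕ} (hn : PolyBounded n)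
    {f : ∀ lam, ι lam → X lam → Fin (n lam) → ZMod (p lam)} (hf : EffFam p f) :
    EffFam p (fun lam i x => weighted (f lam i x)) := by
  unfold NonLin.weighted
  exact sumFin hn (tupleFin hn (mul hf.projSnd
    (const (ι := fun lam => ι lam × Fin (n lam)) fun _ i => 2 ^ (i.2 : ℕ))))

theorem ofBits {n : ℕ → ℕ} (hn : PolyBounded n)
    {f : ∀ lam, ι lam → X lam → BitStr (n lam)} (hf : EffFam p f) :
    EffFam p (fun lam i x => ofBits (p lam) (f lam i x)) := by
  unfold NonLin.ofBits
  exact sumFin hn (tupleFin hn (zcond hf.projSnd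
    (const (ι := fun lam => ι lam × Fin (n lam)) fun _ i => 2 ^ (i.2 : ℕ)) (const fun _ _ => 0)))

theorem bitsOf (hn : PolyBounded fun lam => kappa (p lam))
    {f : ∀ lam, ι lam → X lam → ZMod (p lam)} (hf : EffFam p f) :
    EffFam p (fun lam i x => bitsOf (f lam i x)) := by
  refine tupleFin hn ?_
  have : EffFam p (fun lam (i : ι lam × Fin (kappa (p lam))) (x : ZMod (p lam)) =>
      x.val.testBit i.2) :=
    ⟨fun _ => 1, PolyBounded.const 1, fun lam i => ⟨.bit i.2, le_rfl, rfl⟩⟩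
  exact comp (f := fun lam (i : ι lam × Fin (kappa (p lam))) x => f lam i.1 x) this hf.lift

end EffFam

/-! ### Binary expansions and weighted sums -/

theorem le_two_pow_kappa (q : ℕ) : q ≤ 2 ^ kappa q := Nat.le_pow_clog one_lt_two q

theorem sum_testBit (n k : ℕ) (h : n < 2 ^ k) :
    (∑ i : Fin k, if n.testBit i then 2 ^ (i : ℕ) else 0) = n := by
  induction k generalizing n with
  | zero => simp at h; simp [h]
  | succ k ih =>
    rw [Fin.sum_univ_succ]
    -- The lowest bit is split off; the remaining bits are those of `n / 2`, with doubled weights.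
    have h2 := ih (n / 2) (by rw [pow_succ] at h; omega)
    simp only [Fin.val_succ, Nat.testBit_succ, Fin.val_zero, pow_zero]
    have : (∑ i : Fin k, if (n / 2).testBit i then 2 ^ ((i : ℕ) + 1) else 0) = 2 * (n / 2) := by
      conv_rhs => rw [← h2, Finset.mul_sum]
      refine Finset.sum_congr rfl fun i _ => ?_
      split_ifs
      · ring
      · simp
    rw [this, Nat.testBit_zero]
    by_cases hn : n % 2 = 1 <;> simp [hn] <;> omega

theorem ofBits_bitsOf {q : ℕ} [NeZero q] (x : ZMod q) : ofBits q (bitsOf x) = x := by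
  have h := sum_testBit x.val (kappa q) ((ZMod.val_lt x).trans_le (le_two_pow_kappa q))
  conv_rhs => rw [← ZMod.natCast_zmod_val x, ← h]
  simp only [ofBits, bitsOf, Nat.cast_sum, Nat.cast_ite, Nat.cast_pow, Nat.cast_ofNat, Nat.cast_zero]
  rfl

theorem weighted_bitVal_bitsOf {q : ℕ} [NeZero q] (x : ZMod q) :
    weighted (fun i => bitVal q (bitsOf x i)) = x := by
  conv_rhs => rw [← ofBits_bitsOf x]
  simp [weighted, ofBits, bitVal]

theorem weighted_add {q n : ℕ} (v w : Fin n → ZMod q) :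
    weighted (fun i => v i + w i) = weighted v + weighted w := by
  simp [weighted, add_mul, Finset.sum_add_distrib]

theorem weighted_mul_right {q n : ℕ} (v : Fin n → ZMod q) (a : ZMod q) :
    weighted (fun i => v i * a) = weighted v * a := by
  simp only [weighted, Finset.sum_mul]
  exact Finset.sum_congr rfl fun i _ => by ring

namespace EffFam

variable {p : ℕ → ℕ} [∀ lam, Fact (p lam).Prime] {ι X : ℕ → Type}

/-- Equality is tested on the difference, which vanishes if and only if all its `κ` bits do, since
these bits determine a field element. -/
theorem decideEq (hn : PolyBounded fun lam => kappa (p lam))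
    {f g : ∀ lam, ι lam → X lam → ZMod (p lam)} (hf : EffFam p f) (hg : EffFam p g) :
    EffFam p (fun lam i x => decide (f lam i x = g lam i x)) := by
  have h := forallFin hn (tupleFin (f := fun lam i x j =>
    !(NonLin.bitsOf (f lam i x - g lam i x) j)) hn (not (projSnd (bitsOf hn (sub hf hg)))))
  convert h using 4 with lam i x
  have : f lam i x = g lam i x ↔ f lam i x - g lam i x = 0 := sub_eq_zero.symm
  refine decide_eq_decide.2 (this.trans ⟨fun h0 => ?_, fun h0 => ?_⟩)
  · rw [h0]; simp [NonLin.bitsOf]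
  · rw [← ofBits_bitsOf (f lam i x - g lam i x)]
    simp only [Bool.not_eq_true'] at h0
    simp [NonLin.ofBits, h0]

end EffFam

/-- Hybrid argument: an efficient post-processing with hard-wired random choices preserves
indistinguishability. -/
theorem Indist.bind_map {p : ℕ → ℕ} {W T T' : ℕ → Type} [∀ lam, Fintype (W lam)]
    [∀ lam, Nonempty (W lam)] {X Y : ∀ lam, W lam → PMF (T lam)}
    (h : ∀ w : ∀ lam, W lam, Indist p (fun lam => X lam (w lam)) (fun lam => Y lam (w lam)))
    {F : ∀ lam, W lam → T lam → T' lam} (hF : EffFam p F) :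
    Indist p (fun lam => (unif (W lam)).bind fun w => (X lam w).map (F lam w))
      (fun lam => (unif (W lam)).bind fun w => (Y lam w).map (F lam w)) := by
  intro D hD
  -- The worst choice for this particular distinguisher; `F lam (w lam)` then becomes a circuit
  -- placed in front of it.
  choose w hw using fun lam => exists_abs_accept_unif_bind_le (D lam).eval
    (fun w => (X lam w).map (F lam w)) (fun w => (Y lam w).map (F lam w))
  obtain ⟨c, hc, he⟩ := hF.exists_circ w
  obtain ⟨ν, hν, hle⟩ := h w (fun lam => .comp (c lam) (D lam)) (hc.add hD)
  refine ⟨ν, hν, fun lam => le_trans (hw lam) ?_⟩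
  have hl := hle lam
  rw [advantage_eq] at hl
  rw [accept_map, accept_map]
  simp only [Circ.eval, he] at hl
  exact hl

theorem Indist.map {p : ℕ → ℕ} {T T' : ℕ → Type} {X Y : ∀ lam, PMF (T lam)} (h : Indist p X Y)
    {F : ∀ lam, T lam → T' lam} (hF : EffFam p (fun lam (_ : Unit) => F lam)) :
    Indist p (fun lam => (X lam).map (F lam)) (fun lam => (Y lam).map (F lam)) := by
  have := Indist.bind_map (W := fun _ => Unit) (X := fun lam _ => X lam) (Y := fun lam _ => Y lam)
    (fun _ => h) hF
  simpa [unif] using this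

/-! ## Sampling from coins -/

/-- Uniform elements of `T` can be read off a random tape. -/
def Samplable (q : ℕ) (T : Type) : Prop :=
  ∃ (nb nf : ℕ) (c : Circ q (Coins q nb nf) T), c.size = 0 ∧ Function.Bijective c.eval

namespace Samplable

variable {q : ℕ}

theorem coins (nb nf : ℕ) : Samplable q (Coins q nb nf) :=
  ⟨nb, nf, .id, rfl, Function.bijective_id⟩

theorem of_circ {T T' : Type} (h : Samplable q T) (c : Circ q T T') (hs : c.size = 0)
    (hc : Function.Bijective c.eval) : Samplable q T' := by
  obtain ⟨nb, nf, c', hs', hc'⟩ := h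
  exact ⟨nb, nf, .comp c' c, by simp [Circ.size, hs, hs'], hc.comp hc'⟩

/-- The tapes are laid side by side: the first segment feeds one sampler and the second segment the
other. -/
theorem prod {T T' : Type} (h : Samplable q T) (h' : Samplable q T') : Samplable q (T × T') := by
  obtain ⟨nb, nf, c, hs, hc⟩ := h
  obtain ⟨nb', nf', c', hs', hc'⟩ := h'
  refine ⟨nb + nb', nf + nf', .pair
    (.comp (.pair (.comp .fst (.tuple fun i => .proj (Fin.castAdd nb' i)))
      (.comp .snd (.tuple fun i => .proj (Fin.castAdd nf' i)))) c)
    (.comp (.pair (.comp .fst (.tuple fun i => .proj (Fin.natAdd nb i)))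
      (.comp .snd (.tuple fun i => .proj (Fin.natAdd nf i)))) c'), ?_, ?_⟩
  · simp [Circ.size, hs, hs']
  · constructor
    · intro x y hxy
      simp only [Circ.eval, Prod.mk.injEq] at hxy
      have h1 := hc.1 hxy.1
      have h2 := hc'.1 hxy.2
      simp only [Prod.mk.injEq] at h1 h2
      refine Prod.ext (funext fun i => ?_) (funext fun i => ?_)
      · refine Fin.addCases (fun i => congrFun h1.1 i) (fun i => congrFun h2.1 i) i
      · refine Fin.addCases (fun i => congrFun h1.2 i) (fun i => congrFun h2.2 i) i
    · rintro ⟨t, t'⟩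
      obtain ⟨x, rfl⟩ := hc.2 t
      obtain ⟨x', rfl⟩ := hc'.2 t'
      exact ⟨(Fin.append x.1 x'.1, Fin.append x.2 x'.2), by simp [Circ.eval]⟩

theorem bits (I : Type) [Fintype I] : Samplable q (I → Bool) := by
  refine ⟨Fintype.card I, 0, .comp .fst (.tuple fun i => .proj (Fintype.equivFin I i)), ?_, ?_⟩
  · simp [Circ.size]
  · constructor
    · intro x y hxy
      refine Prod.ext (funext fun i => ?_) (Subsingleton.elim _ _)
      have := congrFun hxy ((Fintype.equivFin I).symm i)
      simpa [Circ.eval] using this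
    · intro t
      exact ⟨(t ∘ (Fintype.equivFin I).symm, fun i => i.elim0), by funext i; simp [Circ.eval]⟩

theorem field (I : Type) [Fintype I] : Samplable q (I → ZMod q) := by
  refine ⟨0, Fintype.card I, .comp .snd (.tuple fun i => .proj (Fintype.equivFin I i)), ?_, ?_⟩
  · simp [Circ.size]
  · constructor
    · intro x y hxy
      refine Prod.ext (Subsingleton.elim _ _) (funext fun i => ?_)
      have := congrFun hxy ((Fintype.equivFin I).symm i)
      simpa [Circ.eval] using this
    · intro t
      exact ⟨(fun i => i.elim0, t ∘ (Fintype.equivFin I).symm), by funext i; simp [Circ.eval]⟩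

theorem zmod : Samplable q (ZMod q) :=
  (field Unit).of_circ (.proj ()) rfl
    ⟨fun _ _ h => funext fun _ => h, fun t => ⟨fun _ => t, rfl⟩⟩

theorem bitStrs (I : Type) [Fintype I] (n : ℕ) : Samplable q (I → BitStr n) :=
  (bits (I × Fin n)).of_circ (.tuple fun i => .tuple fun j => .proj (i, j)) (by simp [Circ.size])
    ⟨fun x y h => funext fun i => congrFun (congrFun h i.1) i.2,
      fun t => ⟨fun i => t i.1 i.2, rfl⟩⟩

end Samplable

/-! ### Efficiency of operations on bit strings -/

namespace EffFam

variable {p : ℕ → ℕ} {ι X : ℕ → Type}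

theorem bxor {n : ℕ → ℕ} (hn : PolyBounded n) {f g : ∀ lam, ι lam → X lam → BitStr (n lam)}
    (hf : EffFam p f) (hg : EffFam p g) : EffFam p (fun lam i x => bxor (f lam i x) (g lam i x)) :=
  tupleFin hn (xor hf.projSnd hg.projSnd)

theorem trun {n h : ℕ → ℕ} {f : ∀ lam, ι lam → X lam → BitStr (n lam)}
    (hf : EffFam p f) : EffFam p (fun lam i x => trun (h lam) (f lam i x)) := by
  have : EffFam p (fun lam (_ : ι lam) (z : BitStr (n lam)) => NonLin.trun (h lam) z) := by
    refine ⟨fun _ => 0, PolyBounded.const 0, fun lam i => ⟨.tuple fun j =>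
      if hi : n lam - h lam + j < n lam then .proj ⟨n lam - h lam + j, hi⟩ else .const false,
      ?_, ?_⟩⟩
    · simp only [Circ.size, nonpos_iff_eq_zero, Finset.sum_eq_zero_iff]
      intro j _
      split_ifs <;> rfl
    · funext z j
      simp only [Circ.eval, NonLin.trun]
      split_ifs <;> rfl
  exact comp this hf

theorem append {m n : ℕ → ℕ} {f : ∀ lam, ι lam → X lam → BitStr (m lam)}
    {g : ∀ lam, ι lam → X lam → BitStr (n lam)} (hf : EffFam p f) (hg : EffFam p g) :
    EffFam p (fun lam i x => (Fin.append (f lam i x) (g lam i x) : BitStr (m lam + n lam))) := by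
  have : EffFam p (fun lam (_ : ι lam) (z : BitStr (m lam) × BitStr (n lam)) =>
      (Fin.append z.1 z.2 : BitStr (m lam + n lam))) := by
    refine ⟨fun _ => 0, PolyBounded.const 0, fun lam i => ⟨.tuple fun j =>
      Fin.addCases (fun j => .comp .fst (.proj j)) (fun j => .comp .snd (.proj j)) j, ?_, ?_⟩⟩
    · simp [Circ.size, Fin.sum_univ_add]
    · funext z j
      refine Fin.addCases (fun j => ?_) (fun j => ?_) j <;> simp [Circ.eval]
  exact comp (f := fun lam i x => (f lam i x, g lam i x)) this (pair hf hg)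

end EffFam

/-- The pair of ciphertexts with content `x` in slot `ξ` and content `y` in the other one. -/
def slots {n : ℕ} (ξ : Bool) (x y : BitStr n) (s : Bool) : BitStr n := if s = ξ then x else y

theorem EffFam.slots {p : ℕ → ℕ} {ι X : ℕ → Type} {n : ℕ → ℕ} (hn : PolyBounded n)
    {ξ : ∀ lam, ι lam → X lam → Bool} {f g : ∀ lam, ι lam → X lam → BitStr (n lam)}
    (hξ : EffFam p ξ) (hf : EffFam p f) (hg : EffFam p g) :
    EffFam p (fun lam i x => slots (ξ lam i x) (f lam i x) (g lam i x)) := by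
  have hB : PolyBounded fun _ => Fintype.card Bool := PolyBounded.const _
  refine EffFam.tuple hB (EffFam.tupleFin hn ?_)
  have h1 : EffFam p (fun lam (i : (ι lam × Bool) × Fin (n lam)) x => ξ lam i.1.1 x) :=
    (hξ.lift (J := fun _ => Bool)).lift
  have h2 : EffFam p (fun lam (i : (ι lam × Bool) × Fin (n lam)) x => f lam i.1.1 x i.2) :=
    EffFam.projSnd (hf.lift (J := fun _ => Bool))
  have h3 : EffFam p (fun lam (i : (ι lam × Bool) × Fin (n lam)) x => g lam i.1.1 x i.2) :=
    EffFam.projSnd (hg.lift (J := fun _ => Bool))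
  have h4 : EffFam p (X := X) (fun lam (i : (ι lam × Bool) × Fin (n lam)) x => !i.1.2) :=
    EffFam.const (ι := fun lam => (ι lam × Bool) × Fin (n lam)) fun lam i => !i.1.2
  -- The slot index `s` is static, and `ξ xor ¬s` is true exactly when `s = ξ`.
  convert (h1.xor h4).bcond h2 h3 using 4 with lam i x
  obtain ⟨⟨i, s⟩, j⟩ := i
  cases s <;> cases ξ lam i x <;> simp [NonLin.slots]

/-! ## The messages to the client -/

section Messages

variable {q lam l : ℕ}

/-- The masks of the opened slots and of the other ones. -/
abbrev MaskRnd (q : ℕ) : Type :=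
  (Fin (kappa q) → ZMod q) × (Fin (kappa q) → ZMod q) × (Fin (kappa q) → ZMod q)

/-- Contents of the ciphertexts that the client cannot open. -/
abbrev Pads (q : ℕ) : Type :=
  (Fin (kappa q) → BitStr (kappa q)) × (Fin (kappa q) → BitStr (kappa q + kappa q))

/-- The first message, if the evaluation of the garbled circuit `y` gives the labels `ev`, the
client decrypts `v = (c, d, e)`, and the ciphertexts that it cannot open are `o`. -/
def msg1Of (ev : Fin (kappa q + kappa q) → Label lam)
    (y : BitStr l × (Fin (kappa q + kappa q) → Label lam)) (v : MaskRnd q) (o : Pads q) :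
    Msg1 q lam l :=
  (y, fun i => slots (ev (Fin.castAdd _ i)).1
      (bxor (bitsOf (v.1 i)) (trun (kappa q) (ev (Fin.castAdd _ i)).2)) (o.1 i),
    fun i => slots (ev (Fin.natAdd _ i)).1
      (bxor (Fin.append (bitsOf (v.2.1 i)) (bitsOf (v.2.2 i)))
        (trun (kappa q + kappa q) (ev (Fin.natAdd _ i)).2)) (o.2 i))

/-- The values that are encrypted under the labels of the bits `b`. -/
def maskedBy (α : ZMod q) (m : MaskRnd q) (b : BitStr (kappa q + kappa q)) : MaskRnd q :=
  (fun i => m.1 i + bitVal q (b (Fin.castAdd _ i)) * α,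
    fun i => m.2.1 i + bitVal q (b (Fin.natAdd _ i)),
    fun i => m.2.2 i + bitVal q (b (Fin.natAdd _ i)) * α)

/-- The encryptions of the values `v` under the strings `z`. -/
def encrypted (v : MaskRnd q) (z : Fin (kappa q + kappa q) → BitStr (lam - 1)) : Pads q :=
  (fun i => bxor (bitsOf (v.1 i)) (trun (kappa q) (z (Fin.castAdd _ i))),
    fun i => bxor (Fin.append (bitsOf (v.2.1 i)) (bitsOf (v.2.2 i)))
      (trun (kappa q + kappa q) (z (Fin.natAdd _ i))))

/-- The masks as a structure. -/
def masksOf (m : MaskRnd q) : Masks q := ⟨m.1, m.2.1, m.2.2⟩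

/-- The two pointer bits of a wire differ, so the slot named by the label of `b i` holds the value
masked for `b i`, and the other slot the value masked for the complement. Separating the two
isolates the labels to which authenticity applies. -/
theorem serverMsg1_eq (g : Garbled lam (kappa q + kappa q) (kappa q + kappa q) l)
    (hg : ∀ i, (g.labOut i true).1 = !(g.labOut i false).1) (u0 α : ZMod q) (m : MaskRnd q)
    (x1 : BitStr (kappa q)) (b : BitStr (kappa q + kappa q)) :
    serverMsg1 g u0 α (masksOf m) x1 =
      msg1Of (fun i => g.labOut i (b i)) (g.gc, g.input (Fin.append (bitsOf u0) x1))
        (maskedBy α m b)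
        (encrypted (maskedBy α m fun i => !(b i)) fun i => (g.labOut i !(b i)).2) := by
  unfold serverMsg1 msg1Of
  refine congrArg₂ _ rfl (congrArg₂ _ (funext fun i => funext fun s => ?_)
    (funext fun i => funext fun s => ?_))
  · have h := hg (Fin.castAdd _ i)
    cases hs : s <;> cases hb : b (Fin.castAdd _ i) <;>
      cases h0 : (g.labOut (Fin.castAdd _ i) false).1 <;>
      simp [ctU, slots, maskedBy, encrypted, masksOf, h, hb, h0]
  · have h := hg (Fin.natAdd _ i)
    cases hs : s <;> cases hb : b (Fin.natAdd _ i) <;>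
      cases h0 : (g.labOut (Fin.natAdd _ i) false).1 <;>
      simp [ctSign, slots, maskedBy, encrypted, masksOf, h, hb, h0, -Fin.natAdd_eq_addNat]

/-- Six field elements. -/
abbrev Six (q : ℕ) : Type := ZMod q × ZMod q × ZMod q × ZMod q × ZMod q × ZMod q

/-- The result of the triple generation from the shares of `S_0`. -/
def tripleOf (α A1 B1 : ZMod q) (s : Six q) :
    TripleShare q × (ZMod q × ZMod q × ZMod q × ZMod q) :=
  (⟨s.1, s.2.1, s.2.2.1, s.2.2.2.1, s.2.2.2.2.1, s.2.2.2.2.2⟩,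
    (α * (s.1 + A1) - s.2.2.2.1, α * (s.2.1 + B1) - s.2.2.2.2.1,
      (s.1 + A1) * (s.2.1 + B1) - s.2.2.1, α * ((s.1 + A1) * (s.2.1 + B1)) - s.2.2.2.2.2))

theorem tripleGen_eq [Fact q.Prime] (α A1 B1 : ZMod q) :
    tripleGen α A1 B1 = (unif (Six q)).bind fun s => PMF.pure (tripleOf α A1 B1 s) := by
  unfold tripleGen
  simp only [pmf_bind_eq, pmf_pure_eq, unif_bind_prod]
  rfl

/-- The test of `S_0` on the opening. -/
def openingOk (u0 α : ZMod q) (M : Masks q) (t : TripleShare q) (o : Opening q) : Bool :=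
  o.1 && (decide ((share1 M - t.aA) + o.2.1.2 = α * ((serverOpen u0 M t).1 + o.2.1.1)) &&
    decide ((share3 M - t.aB) + o.2.2.2 = α * ((serverOpen u0 M t).2 + o.2.2.1)))

/-- The output of `S_0` on the shares `z`, or `(false, 0, 0, 0)` if the test fails. -/
def outputIf (b : Bool) (z : ZMod q × ZMod q × ZMod q) : ServerOut q :=
  if b = true then (true, z) else (false, 0, 0, 0)

/-- The output shares of `S_0` if it does not abort. -/
def finalShares (u0 α : ZMod q) (M : Masks q) (t : TripleShare q) (o : Opening q) :
    ZMod q × ZMod q × ZMod q :=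
  let Γ := (serverOpen u0 M t).1 + o.2.1.1
  let Λ := (serverOpen u0 M t).2 + o.2.2.1
  (share1 M, t.C + Γ * t.B + Λ * t.A + Γ * Λ, t.aC + Γ * t.aB + Λ * t.aA + α * (Γ * Λ))

theorem serverFinish_eq (u0 α : ZMod q) (M : Masks q) (t : TripleShare q) (o : Opening q) :
    serverFinish u0 α M t o = outputIf (openingOk u0 α M t o) (finalShares u0 α M t o) := by
  simp only [serverFinish, outputIf, openingOk, finalShares, Bool.and_eq_true, decide_eq_true_eq]

end Messages

/-! ### Efficiency of outputs and messages -/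

theorem EffFam.outputIf {p : ℕ → ℕ} {ι X : ℕ → Type} {b : ∀ lam, ι lam → X lam → Bool}
    {z : ∀ lam, ι lam → X lam → ZMod (p lam) × ZMod (p lam) × ZMod (p lam)}
    (hb : EffFam p b) (hz : EffFam p z) :
    EffFam p (fun lam i x => outputIf (b lam i x) (z lam i x)) := by
  have h0 : EffFam p (X := X) (ι := ι) (fun lam _ _ => (0 : ZMod (p lam))) :=
    EffFam.const fun _ _ => 0
  convert EffFam.pair hb ((hb.zcond hz.fst h0).pair ((hb.zcond hz.snd.fst h0).pair
    (hb.zcond hz.snd.snd h0))) using 4 with lam i x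
  cases b lam i x <;> simp [NonLin.outputIf]

theorem EffFam.msg1Of {p : ℕ → ℕ} {ι X : ℕ → Type} {l : ℕ → ℕ}
    (hn : PolyBounded fun lam => kappa (p lam))
    {ev : ∀ lam, ι lam → X lam → Fin (kappa (p lam) + kappa (p lam)) → Label lam}
    {y : ∀ lam, ι lam → X lam →
      BitStr (l lam) × (Fin (kappa (p lam) + kappa (p lam)) → Label lam)}
    {v : ∀ lam, ι lam → X lam → MaskRnd (p lam)} {o : ∀ lam, ι lam → X lam → Pads (p lam)}
    (hev : EffFam p ev) (hy : EffFam p y) (hv : EffFam p v) (ho : EffFam p o) :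
    EffFam p (fun lam i x =>
      msg1Of (ev lam i x) (y lam i x) (v lam i x) (o lam i x)) := by
  have evU : EffFam p (fun lam (i : ι lam × Fin (kappa (p lam))) x =>
      ev lam i.1 x (Fin.castAdd _ i.2)) :=
    EffFam.proj (f := fun lam (i : ι lam × Fin (kappa (p lam))) x => ev lam i.1 x)
      hev.lift fun lam i => Fin.castAdd _ i.2
  have evS : EffFam p (fun lam (i : ι lam × Fin (kappa (p lam))) x =>
      ev lam i.1 x (Fin.natAdd _ i.2)) :=
    EffFam.proj (f := fun lam (i : ι lam × Fin (kappa (p lam))) x => ev lam i.1 x)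
      hev.lift fun lam i => Fin.natAdd _ i.2
  refine EffFam.pair hy (EffFam.pair (EffFam.tupleFin hn ?_) (EffFam.tupleFin hn ?_))
  · exact EffFam.slots hn evU.fst (EffFam.bxor hn (EffFam.bitsOf hn hv.fst.projSnd)
      (EffFam.trun evU.snd)) ho.fst.projSnd
  · exact EffFam.slots (hn.add hn) evS.fst (EffFam.bxor (hn.add hn) (EffFam.append
      (EffFam.bitsOf hn hv.snd.fst.projSnd) (EffFam.bitsOf hn hv.snd.snd.projSnd))
      (EffFam.trun evS.snd)) ho.snd.projSnd

theorem EffFam.encrypted {p : ℕ → ℕ} {ι X : ℕ → Type}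
    (hn : PolyBounded fun lam => kappa (p lam))
    {v : ∀ lam, ι lam → X lam → MaskRnd (p lam)}
    {z : ∀ lam, ι lam → X lam → Fin (kappa (p lam) + kappa (p lam)) → BitStr (lam - 1)}
    (hv : EffFam p v) (hz : EffFam p z) :
    EffFam p (fun lam i x => encrypted (v lam i x) (z lam i x)) := by
  have zU : EffFam p (fun lam (i : ι lam × Fin (kappa (p lam))) x =>
      z lam i.1 x (Fin.castAdd _ i.2)) :=
    EffFam.proj (f := fun lam (i : ι lam × Fin (kappa (p lam))) x => z lam i.1 x)
      hz.lift fun lam i => Fin.castAdd _ i.2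
  have zS : EffFam p (fun lam (i : ι lam × Fin (kappa (p lam))) x =>
      z lam i.1 x (Fin.natAdd _ i.2)) :=
    EffFam.proj (f := fun lam (i : ι lam × Fin (kappa (p lam))) x => z lam i.1 x)
      hz.lift fun lam i => Fin.natAdd _ i.2
  refine EffFam.pair (EffFam.tupleFin hn ?_) (EffFam.tupleFin hn ?_)
  · exact EffFam.bxor hn (EffFam.bitsOf hn hv.fst.projSnd) (EffFam.trun zU)
  · exact EffFam.bxor (hn.add hn) (EffFam.append
      (EffFam.bitsOf hn hv.snd.fst.projSnd) (EffFam.bitsOf hn hv.snd.snd.projSnd))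
      (EffFam.trun zS)

/-- Encryption under uniform strings that are long enough gives uniform ciphertexts. -/
theorem unif_map_encrypted {q lam : ℕ} (h : kappa q + kappa q ≤ lam - 1) (v : MaskRnd q) :
    (unif (Fin (kappa q + kappa q) → BitStr (lam - 1))).map (encrypted v) = unif (Pads q) := by
  have hinj : ∀ {n : ℕ} (k : BitStr n), Function.Injective (bxor k) := by
    intro n k a b hab
    funext i
    simpa [bxor] using congrFun hab i
  -- Translations by exclusive or act transitively on the ciphertexts; each is induced by a
  -- translation of the keys.
  refine unif_map_of_equivariant _ fun b b' => ?_
  let mU : Fin (kappa q) → BitStr (kappa q) := fun i => bxor (b.1 i) (b'.1 i)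
  let mS : Fin (kappa q) → BitStr (kappa q + kappa q) := fun i => bxor (b.2 i) (b'.2 i)
  -- Places `m` in the last `h` positions, those that `trun` keeps, and zeros in front of them.
  let ext : ∀ {h : ℕ}, BitStr h → BitStr (lam - 1) := fun {h} m k =>
    if hk : (k : ℕ) - (lam - 1 - h) < h then m ⟨k - (lam - 1 - h), hk⟩ else false
  have hext : ∀ {h : ℕ} (_ : h ≤ lam - 1) (m : BitStr h) (z : BitStr (lam - 1)),
      trun h (bxor (ext m) z) = bxor m (trun h z) := by
    intro h hh m z
    funext i
    have hi : lam - 1 - h + i < lam - 1 := by have := i.2; omega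
    simp [trun, bxor, hi, ext]
  refine ⟨fun o => (fun i => bxor (mU i) (o.1 i), fun i => bxor (mS i) (o.2 i)),
    fun z => Fin.append (fun i => bxor (ext (mU i)) (z (Fin.castAdd _ i)))
      (fun i => bxor (ext (mS i)) (z (Fin.natAdd _ i))), ?_, ?_, ?_, ?_⟩
  · intro o o' ho
    simp only [Prod.mk.injEq] at ho
    exact Prod.ext (funext fun i => hinj _ (congrFun ho.1 i))
      (funext fun i => hinj _ (congrFun ho.2 i))
  · intro z z' hz
    funext i
    refine Fin.addCases (fun i => ?_) (fun i => ?_) i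
    · have := congrFun hz (Fin.castAdd _ i)
      simp only [Fin.append_left] at this
      exact hinj _ this
    · have := congrFun hz (Fin.natAdd _ i)
      simp only [Fin.append_right] at this
      exact hinj _ this
  · refine Prod.ext (funext fun i => funext fun j => ?_) (funext fun i => funext fun j => ?_)
    · simp only [mU, bxor]
      cases b.1 i j <;> cases b'.1 i j <;> rfl
    · simp only [mS, bxor]
      cases b.2 i j <;> cases b'.2 i j <;> rfl
  · intro z
    refine Prod.ext (funext fun i => ?_) (funext fun i => ?_)
    · simp only [encrypted, Fin.append_left, hext (show kappa q ≤ lam - 1 by omega)]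
      funext j
      simp only [bxor]
      exact Bool.xor_left_comm _ _ _
    · simp only [encrypted, Fin.append_right, hext h]
      funext j
      simp only [bxor]
      exact Bool.xor_left_comm _ _ _

set_option synthInstance.maxSize 1000

/-- Correctness and point-and-permute hold only on the support of `Garble`, so the integrands need
to agree only there. -/
theorem pmf_bind_congr {A B : Type} (μ : PMF A) {f g : A → PMF B}
    (h : ∀ a ∈ μ.support, f a = g a) : μ.bind f = μ.bind g := by
  ext b
  simp only [PMF.bind_apply]
  refine tsum_congr fun a => ?_
  by_cases ha : μ a = 0
  · simp [ha]
  · rw [h a ((PMF.mem_support_iff _ _).2 ha)]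

/-! ## Hybrid executions -/

section Hybrids

variable {p : ℕ → ℕ} {G : GarblingScheme}
  {booln : ∀ lam, BoolCircuit (kappa (p lam) + kappa (p lam)) (kappa (p lam) + kappa (p lam))}

/-- The execution as a function of the random choices and of the first message to the client. -/
def outcome (Adv : Adversary p (protoLen G booln)) (lam : ℕ) (u0 α : ZMod (p lam))
    (r : Coins (p lam) (Adv.nb lam) (Adv.nf lam)) (m : MaskRnd (p lam)) (s : Six (p lam))
    (m1 : Msg1 (p lam) lam (protoLen G booln lam)) :
    ZMod (p lam) × ServerOut (p lam) × Adv.View lam :=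
  let ab := (Adv.choose2 lam).eval (r, m1)
  let t := tripleOf α ab.1 ab.2 s
  let m2 := (t.2, serverOpen u0 (masksOf m) t.1)
  let o := (Adv.choose3 lam).eval (r, m1, m2)
  (α, serverFinish u0 α (masksOf m) t.1 o, (r, m1, m2))

theorem PolyBounded.kappa (hlam : ∀ᶠ lam in atTop, 2 * kappa (p lam) < lam) :
    PolyBounded fun lam => kappa (p lam) :=
  PolyBounded.self.mono (by filter_upwards [hlam] with lam h; omega)

/-- The random choices of `S_0` (except for the garbling) and of the client. -/
abbrev ExecRnd (Adv : Adversary p (protoLen G booln)) (lam : ℕ) : Type :=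
  (ZMod (p lam) × Coins (p lam) (Adv.nb lam) (Adv.nf lam)) ×
    ((Fin (kappa (p lam)) → ZMod (p lam)) × (Fin (kappa (p lam)) → ZMod (p lam)) ×
      (Fin (kappa (p lam)) → ZMod (p lam)) × Six (p lam))

variable {Adv : Adversary p (protoLen G booln)} {lam : ℕ}

/-- The masks. -/
def ExecRnd.masks (w : ExecRnd Adv lam) : MaskRnd (p lam) := (w.2.1, w.2.2.1, w.2.2.2.1)

/-- The input of the garbled circuit. -/
def ExecRnd.input (w : ExecRnd Adv lam) (u0 : ZMod (p lam)) :
    BitStr (kappa (p lam) + kappa (p lam)) :=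
  Fin.append (bitsOf u0) ((Adv.choose1 lam).eval w.1.2)

/-- The execution in which the client sees the garbled circuit and garbled input `y` and cannot
open the ciphertexts `o`. -/
def ExecRnd.run (w : ExecRnd Adv lam) (u0 : ZMod (p lam))
    (y : BitStr (protoLen G booln lam) × (Fin (kappa (p lam) + kappa (p lam)) → Label lam))
    (o : Pads (p lam)) : ZMod (p lam) × ServerOut (p lam) × Adv.View lam :=
  outcome Adv lam u0 w.1.1 w.1.2 w.masks w.2.2.2.2
    (msg1Of (G.gcEval lam (booln lam) y.1 y.2) y
      (maskedBy w.1.1 w.masks ((booln lam).eval (w.input u0))) o)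

/-- The execution given the labels `z` of the complement of the output. -/
def ExecRnd.runWith (w : ExecRnd Adv lam) (u0 : ZMod (p lam))
    (y : BitStr (protoLen G booln lam) × (Fin (kappa (p lam) + kappa (p lam)) → Label lam))
    (z : Fin (kappa (p lam) + kappa (p lam)) → BitStr (lam - 1)) :
    ZMod (p lam) × ServerOut (p lam) × Adv.View lam :=
  w.run u0 y (encrypted (maskedBy w.1.1 w.masks fun i => !((booln lam).eval (w.input u0) i)) z)

/-- The remaining draws do not depend on the garbling, which can therefore be drawn last. For fixed
other choices everything is then a function of the evaluator's view and the labels of the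
complement, which is the form in which authenticity is stated. -/
theorem realExec_eq [∀ lam, Fact (p lam).Prime] (hPP : G.PointAndPermute) (hCorr : G.Correct) (u0 : ZMod (p lam)) :
    realExec G booln Adv lam u0 = (unif (ExecRnd Adv lam)).bind fun w =>
      (G.otherReal lam (booln lam) (w.input u0)).map fun z =>
        w.runWith u0 z.1 fun i => (z.2 i).2 := by
  unfold realExec
  simp only [pmf_bind_eq, pmf_pure_eq, tripleGen_eq, PMF.bind_bind, PMF.pure_bind, unif_bind_prod]
  -- Moves the garbling behind the masks and the triple shares.
  simp_rw [PMF.bind_comm (G.garble lam (booln lam)), unif_bind_prod]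
  congr 1
  funext (w : ExecRnd Adv lam)
  rw [GarblingScheme.otherReal, PMF.map_comp, ← PMF.bind_pure_comp]
  refine pmf_bind_congr _ fun g hg => ?_
  simp only [Function.comp_apply]
  refine congrArg PMF.pure ?_
  have h1 := serverMsg1_eq g (hPP lam _ _ (booln lam) g hg) u0 w.1.1 w.masks
    ((Adv.choose1 lam).eval w.1.2) ((booln lam).eval (w.input u0))
  have h2 := hCorr lam _ _ (booln lam) (w.input u0) g hg
  rw [ExecRnd.runWith, ExecRnd.run, h2]
  exact congrArg (outcome Adv lam u0 w.1.1 w.1.2 w.masks w.2.2.2.2) h1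

/-- Uniform labels hide the ciphertexts that the client cannot open. -/
theorem otherUniform_map_runWith (h : 2 * kappa (p lam) < lam) (u0 : ZMod (p lam))
    (w : ExecRnd Adv lam) :
    ((G.otherUniform lam (booln lam) (w.input u0)).map fun z =>
        w.runWith u0 z.1 fun i => (z.2 i).2) =
      (unif (Pads (p lam))).bind fun o =>
        (G.evalView lam (booln lam) (w.input u0)).map fun y => w.run u0 y o := by
  unfold GarblingScheme.otherUniform GarblingScheme.evalView
  simp only [pmf_bind_eq, pmf_pure_eq, PMF.map_bind, PMF.pure_map, PMF.map_comp]
  simp only [← PMF.bind_pure_comp]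
  rw [PMF.bind_comm (unif (Pads (p lam)))]
  congr 1
  funext g
  -- The first bits in `otherUniform` play no role here: the slots are arranged by the labels that
  -- the evaluation yields.
  exact unif_bind_of_map (unif_map_encrypted (by omega) _)
    (fun o => PMF.pure (w.run u0 (g.gc, g.input (w.input u0)) o))

end Hybrids

/-! ### The two computational hybrids -/

section HybridsEfficient

variable {p : ℕ → ℕ} {G : GarblingScheme}
  {booln : ∀ lam, BoolCircuit (kappa (p lam) + kappa (p lam)) (kappa (p lam) + kappa (p lam))}
  {Adv : Adversary p (protoLen G booln)} [∀ lam, Fact (p lam).Prime]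

/-- The reduction runs both the client and `S_0`. Key, input, masks and triple shares are
hard-wired; only what depends on the first message is computed by gates. -/
theorem EffFam.outcome (hn : PolyBounded fun lam => kappa (p lam)) (hAdv : Adv.PolySize)
    {ι : ℕ → Type} (u0 α : ∀ lam, ι lam → ZMod (p lam))
    (r : ∀ lam, ι lam → Coins (p lam) (Adv.nb lam) (Adv.nf lam))
    (m : ∀ lam, ι lam → MaskRnd (p lam)) (s : ∀ lam, ι lam → Six (p lam)) :
    EffFam p (fun lam i m1 =>
      outcome Adv lam (u0 lam i) (α lam i) (r lam i) (m lam i) (s lam i) m1) := by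
  have C : ∀ c : ∀ lam, ι lam → ZMod (p lam),
      EffFam p (X := fun lam => Msg1 (p lam) lam (protoLen G booln lam)) fun lam i _ => c lam i :=
    fun c => EffFam.const c
  have hr : EffFam p (X := fun lam => Msg1 (p lam) lam (protoLen G booln lam))
    fun lam i _ => r lam i := EffFam.const r
  have hm : EffFam p (ι := ι) (X := fun lam => Msg1 (p lam) lam (protoLen G booln lam))
    fun _ _ m1 => m1 := EffFam.id
  have hab := EffFam.comp (EffFam.of_circ (ι := ι) Adv.choose2 hAdv.2.1) (hr.pair hm)
  have hA := (C fun lam i => (s lam i).1).add hab.fst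
  have hB := (C fun lam i => (s lam i).2.1).add hab.snd
  have hm2 := EffFam.pair
    (((C α).mul hA |>.sub (C fun lam i => (s lam i).2.2.2.1)).pair
      (((C α).mul hB |>.sub (C fun lam i => (s lam i).2.2.2.2.1)).pair
        ((hA.mul hB |>.sub (C fun lam i => (s lam i).2.2.1)).pair
          ((C α).mul (hA.mul hB) |>.sub (C fun lam i => (s lam i).2.2.2.2.2)))))
    ((C fun lam i => u0 lam i - (s lam i).1).pair
      (C fun lam i => share2 (masksOf (m lam i)) - (s lam i).2.1))
  have ho := EffFam.comp (EffFam.of_circ (ι := ι) Adv.choose3 hAdv.2.2) (hr.pair (hm.pair hm2))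
  have hΓ := (C fun lam i => u0 lam i - (s lam i).1).add ho.snd.fst.fst
  have hΛ := (C fun lam i => share2 (masksOf (m lam i)) - (s lam i).2.1).add ho.snd.snd.fst
  have hok := ho.fst.and (EffFam.and
    (EffFam.decideEq hn ((C fun lam i => share1 (masksOf (m lam i)) - (s lam i).2.2.2.1).add
      ho.snd.fst.snd) ((C α).mul hΓ))
    (EffFam.decideEq hn ((C fun lam i => share3 (masksOf (m lam i)) - (s lam i).2.2.2.2.1).add
      ho.snd.snd.snd) ((C α).mul hΛ)))
  have hz := (C fun lam i => share1 (masksOf (m lam i))).pair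
    (((((C fun lam i => (s lam i).2.2.1).add (hΓ.mul (C fun lam i => (s lam i).2.1))).add
      (hΛ.mul (C fun lam i => (s lam i).1))).add (hΓ.mul hΛ)).pair
    ((((C fun lam i => (s lam i).2.2.2.2.2).add (hΓ.mul (C fun lam i => (s lam i).2.2.2.2.1))).add
      (hΛ.mul (C fun lam i => (s lam i).2.2.2.1))).add ((C α).mul (hΓ.mul hΛ))))
  have hfin := (C α).pair ((EffFam.outputIf hok hz).pair (hr.pair (hm.pair hm2)))
  unfold NonLin.outcome
  simp only [serverFinish_eq]
  exact hfin

/-- The reduction gets the labels that open ciphertexts by running `GCEval` on its challenge. The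
decrypted values depend only on hard-wired data, because the circuit input is fixed by `⟨u⟩₀` and
the coins of the client. -/
theorem EffFam.run (hn : PolyBounded fun lam => kappa (p lam)) (hAdv : Adv.PolySize)
    (hSize : PolyBounded fun lam => (booln lam).size) (hEff : G.Efficient p)
    (u0 : ∀ lam, ZMod (p lam)) :
    EffFam p (fun lam (w : ExecRnd Adv lam) (x : (BitStr (protoLen G booln lam) ×
      (Fin (kappa (p lam) + kappa (p lam)) → Label lam)) × Pads (p lam)) =>
        w.run (u0 lam) x.1 x.2) := by
  obtain ⟨E, hE, he⟩ := hEff _ _ booln ⟨hn.add hn, hn.add hn, hSize⟩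
  have hx : EffFam p (ι := ExecRnd Adv) (X := fun lam => (BitStr (protoLen G booln lam) ×
      (Fin (kappa (p lam) + kappa (p lam)) → Label lam)) × Pads (p lam)) fun _ _ x => x :=
    EffFam.id
  have hev := EffFam.comp (EffFam.of_circ (ι := ExecRnd Adv) E hE) hx.fst
  have hv : EffFam p (X := fun lam => (BitStr (protoLen G booln lam) ×
      (Fin (kappa (p lam) + kappa (p lam)) → Label lam)) × Pads (p lam))
      fun lam (w : ExecRnd Adv lam) _ =>
        maskedBy w.1.1 w.masks ((booln lam).eval (w.input (u0 lam))) := EffFam.const _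
  have h := EffFam.comp (EffFam.outcome hn hAdv (ι := ExecRnd Adv) (fun lam _ => u0 lam)
    (fun _ w => w.1.1) (fun _ w => w.1.2) (fun _ w => w.masks) (fun _ w => w.2.2.2.2))
    (EffFam.msg1Of hn hev hx.fst hv hx.snd)
  simp only [he] at h
  exact h

/-- By authenticity, the ciphertexts that the client cannot open can be replaced by random ones. -/
theorem indist_realExec_pads (hlam : ∀ᶠ lam in atTop, 2 * kappa (p lam) < lam)
    (hAdv : Adv.PolySize) (hSize : PolyBounded fun lam => (booln lam).size)
    (hEff : G.Efficient p) (hPP : G.PointAndPermute) (hCorr : G.Correct) (hAuth : G.Authentic p)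
    (u0 : ∀ lam, ZMod (p lam)) :
    Indist p (fun lam => realExec G booln Adv lam (u0 lam))
      (fun lam => (unif (ExecRnd Adv lam × Pads (p lam))).bind fun w =>
        (G.evalView lam (booln lam) (w.1.input (u0 lam))).map fun y =>
          w.1.run (u0 lam) y w.2) := by
  have hn := PolyBounded.kappa hlam
  have hF : EffFam p (fun lam (w : ExecRnd Adv lam) (z : (BitStr (protoLen G booln lam) ×
      (Fin (kappa (p lam) + kappa (p lam)) → Label lam)) ×
        (Fin (kappa (p lam) + kappa (p lam)) → Label lam)) =>
      w.runWith (u0 lam) z.1 fun i => (z.2 i).2) := by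
    have hz : EffFam p (ι := ExecRnd Adv) (X := fun lam => (BitStr (protoLen G booln lam) ×
      (Fin (kappa (p lam) + kappa (p lam)) → Label lam)) ×
        (Fin (kappa (p lam) + kappa (p lam)) → Label lam)) fun _ _ z => z := EffFam.id
    have hv : EffFam p (X := fun lam => (BitStr (protoLen G booln lam) ×
      (Fin (kappa (p lam) + kappa (p lam)) → Label lam)) ×
        (Fin (kappa (p lam) + kappa (p lam)) → Label lam))
      fun lam (w : ExecRnd Adv lam) _ => maskedBy w.1.1 w.masks
        fun i => !((booln lam).eval (w.input (u0 lam)) i) := EffFam.const _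
    have hl := EffFam.tupleFin (hn.add hn) (f := fun lam (_ : ExecRnd Adv lam)
      (z : (BitStr (protoLen G booln lam) × (Fin (kappa (p lam) + kappa (p lam)) → Label lam)) ×
        (Fin (kappa (p lam) + kappa (p lam)) → Label lam)) i => (z.2 i).2) hz.snd.projSnd.snd
    exact EffFam.comp (f := fun lam (w : ExecRnd Adv lam) (z : (BitStr (protoLen G booln lam) ×
      (Fin (kappa (p lam) + kappa (p lam)) → Label lam)) ×
        (Fin (kappa (p lam) + kappa (p lam)) → Label lam)) => (z.1, NonLin.encrypted (maskedBy w.1.1 w.masks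
        fun i => !((booln lam).eval (w.input (u0 lam)) i)) fun i => (z.2 i).2))
      (EffFam.run hn hAdv hSize hEff u0) (hz.fst.pair (EffFam.encrypted hn hv hl))
  -- The bits used in the oblivious transfers depend only on the client's coins, so each fixed
  -- choice `w` fixes the input of the garbled circuit, as authenticity requires.
  have h1 : Indist p
      (fun lam => (unif (ExecRnd Adv lam)).bind fun w =>
        (G.otherReal lam (booln lam) (w.input (u0 lam))).map fun z =>
          w.runWith (u0 lam) z.1 fun i => (z.2 i).2)
      (fun lam => (unif (ExecRnd Adv lam)).bind fun w =>
        (G.otherUniform lam (booln lam) (w.input (u0 lam))).map fun z =>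
          w.runWith (u0 lam) z.1 fun i => (z.2 i).2) :=
    Indist.bind_map (X := fun lam (w : ExecRnd Adv lam) =>
        G.otherReal lam (booln lam) (w.input (u0 lam)))
      (Y := fun lam (w : ExecRnd Adv lam) => G.otherUniform lam (booln lam) (w.input (u0 lam)))
      (fun w => hAuth _ _ booln ⟨hn.add hn, hn.add hn, hSize⟩ fun lam => (w lam).input (u0 lam)) hF
  have h0 : (fun lam => realExec G booln Adv lam (u0 lam)) = _ :=
    funext fun lam => realExec_eq hPP hCorr (u0 lam)
  rw [h0]
  refine h1.trans (indist_of_eventually_eq ?_)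
  -- Labels are long enough for the one-time pad only for large `lam`.
  filter_upwards [hlam] with lam hl
  rw [← unif_bind_prod (fun (w : ExecRnd Adv lam) o =>
    (G.evalView lam (booln lam) (w.input (u0 lam))).map fun y => w.run (u0 lam) y o)]
  exact congrArg _ (funext fun w => otherUniform_map_runWith hl (u0 lam) w)

/-- By the security of the garbling scheme, the garbled circuit can be simulated. -/
theorem indist_realExec_sim (hlam : ∀ᶠ lam in atTop, 2 * kappa (p lam) < lam)
    (hAdv : Adv.PolySize) (hSize : PolyBounded fun lam => (booln lam).size)
    (hEff : G.Efficient p) (hPP : G.PointAndPermute) (hCorr : G.Correct) (hAuth : G.Authentic p)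
    {nb nf : ℕ → ℕ} {S : ∀ lam, Circ (p lam) (Coins (p lam) (nb lam) (nf lam))
      (BitStr (protoLen G booln lam) × (Fin (kappa (p lam) + kappa (p lam)) → Label lam))}
    (hS : ∀ x : ∀ lam, BitStr (kappa (p lam) + kappa (p lam)),
      Indist p (fun lam => G.evalView lam (booln lam) (x lam))
        (fun lam => (unif (Coins (p lam) (nb lam) (nf lam))).map (S lam).eval))
    (u0 : ∀ lam, ZMod (p lam)) :
    Indist p (fun lam => realExec G booln Adv lam (u0 lam))
      (fun lam => (unif (ExecRnd Adv lam × Pads (p lam))).bind fun w =>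
        (unif (Coins (p lam) (nb lam) (nf lam))).map fun x =>
          w.1.run (u0 lam) ((S lam).eval x) w.2) := by
  have hn := PolyBounded.kappa hlam
  refine (indist_realExec_pads hlam hAdv hSize hEff hPP hCorr hAuth u0).trans ?_
  have hF : EffFam p (fun lam (w : ExecRnd Adv lam × Pads (p lam))
      (y : BitStr (protoLen G booln lam) × (Fin (kappa (p lam) + kappa (p lam)) → Label lam)) =>
      w.1.run (u0 lam) y w.2) :=
    EffFam.comp (f := fun lam (w : ExecRnd Adv lam × Pads (p lam)) (y : BitStr (protoLen G booln lam) ×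
        (Fin (kappa (p lam) + kappa (p lam)) → Label lam)) => (y, w.2))
      (g := fun lam (w : ExecRnd Adv lam × Pads (p lam)) x => w.1.run (u0 lam) x.1 x.2)
      ((EffFam.run hn hAdv hSize hEff u0).reindex
        (κ := fun lam => ExecRnd Adv lam × Pads (p lam)) fun _ w => w.1)
      (EffFam.id.pair (EffFam.const (ι := fun lam => ExecRnd Adv lam × Pads (p lam))
        fun _ w => w.2))
  have h := Indist.bind_map (X := fun lam (w : ExecRnd Adv lam × Pads (p lam)) =>
      G.evalView lam (booln lam) (w.1.input (u0 lam)))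
    (Y := fun lam _ => (unif (Coins (p lam) (nb lam) (nf lam))).map (S lam).eval)
    (fun w => hS fun lam => (w lam).1.input (u0 lam)) hF
  simp only [PMF.map_comp] at h
  exact h

end HybridsEfficient

/-! ### Prescribing a weighted sum -/

/-- Change the first entry of `c` such that the weighted sum becomes `k`. -/
def adjust {q n : ℕ} (c : Fin n → ZMod q) (k : ZMod q) : Fin n → ZMod q :=
  fun i => c i + (if (i : ℕ) = 0 then 1 else 0) * (k - weighted c)

/-- The first entry has weight `2^0 = 1`, so the missing amount can be added to it without division.
-/
theorem weighted_adjust {q n : ℕ} (hn : 0 < n) (c : Fin n → ZMod q) (k : ZMod q) :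
    weighted (adjust c k) = k := by
  have h : weighted (fun i : Fin n => if (i : ℕ) = 0 then (1 : ZMod q) else 0) = 1 := by
    obtain ⟨n, rfl⟩ := Nat.exists_eq_succ_of_ne_zero hn.ne'
    simp [weighted]
  unfold adjust
  rw [weighted_add, weighted_mul_right, h]
  ring

/-- The correction overwrites only the first entry, and `k` survives as the weighted sum; hence the
old first entry is all that is lost. -/
theorem adjust_injective {q n : ℕ} (i0 : Fin n) (hi : (i0 : ℕ) = 0) {c c' : Fin n → ZMod q}
    {k k' : ZMod q} (h : adjust c k = adjust c' k') (h0 : c i0 = c' i0) : c = c' ∧ k = k' := by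
  have hn : 0 < n := i0.pos
  refine ⟨funext fun i => ?_, ?_⟩
  · by_cases hi' : (i : ℕ) = 0
    · have : i = i0 := Fin.ext (hi'.trans hi.symm)
      rw [this, h0]
    · simpa [adjust, hi'] using congrFun h i
  · rw [← weighted_adjust hn c k, h, weighted_adjust hn]

theorem EffFam.adjust {p : ℕ → ℕ} {ι X : ℕ → Type} {n : ℕ → ℕ} (hn : PolyBounded n)
    {c : ∀ lam, ι lam → X lam → Fin (n lam) → ZMod (p lam)}
    {k : ∀ lam, ι lam → X lam → ZMod (p lam)} (hc : EffFam p c) (hk : EffFam p k) :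
    EffFam p (fun lam i x => adjust (c lam i x) (k lam i x)) :=
  EffFam.tupleFin hn (hc.projSnd.add (EffFam.mul (EffFam.const
    (ι := fun lam => ι lam × Fin (n lam)) fun _ i => if (i.2 : ℕ) = 0 then 1 else 0)
    (hk.sub (EffFam.weighted hn hc)).lift))

theorem kappa_pos (q : ℕ) [Fact q.Prime] : 0 < kappa q :=
  Nat.clog_pos one_lt_two (Fact.out : q.Prime).two_le

/-! ## Change of variables -/

section ChangeOfVariables

variable {q : ℕ}

/-- The masks for which the values `v` are encrypted under the labels of the bits `b`. -/
def unmaskedBy (α : ZMod q) (v : MaskRnd q) (b : BitStr (kappa q + kappa q)) : MaskRnd q :=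
  (fun i => v.1 i - bitVal q (b (Fin.castAdd _ i)) * α,
    fun i => v.2.1 i - bitVal q (b (Fin.natAdd _ i)),
    fun i => v.2.2 i - bitVal q (b (Fin.natAdd _ i)) * α)

theorem maskedBy_unmaskedBy (α : ZMod q) (v : MaskRnd q) (b : BitStr (kappa q + kappa q)) :
    maskedBy α (unmaskedBy α v b) b = v := by
  simp [maskedBy, unmaskedBy]

/-- The shares of `S_0` of the triple, if the client receives
`t = (⟨Γ⟩₀, ⟨Λ⟩₀, ⟨αA⟩₁, ⟨αB⟩₁, ⟨C⟩₁, ⟨αC⟩₁)`, and the second share of `S_0` is `g`. -/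
def sixOf (u0 g α A1 B1 : ZMod q) (t : Six q) : Six q :=
  (u0 - t.1, g - t.2.1, (u0 - t.1 + A1) * (g - t.2.1 + B1) - t.2.2.2.2.1,
    α * (u0 - t.1 + A1) - t.2.2.1, α * (g - t.2.1 + B1) - t.2.2.2.1,
    α * ((u0 - t.1 + A1) * (g - t.2.1 + B1)) - t.2.2.2.2.2)

theorem unmaskedBy_injective (α : ZMod q) (b : BitStr (kappa q + kappa q)) :
    Function.Injective fun v : MaskRnd q => unmaskedBy α v b := fun v w h => by
  rw [← maskedBy_unmaskedBy α v b, ← maskedBy_unmaskedBy α w b]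
  exact congrArg (fun m => maskedBy α m b) h

/-- The system is triangular: the first two components determine `t.1` and `t.2.1`, and each further
component is then a known value minus one coordinate of `t`. -/
theorem sixOf_injective (u0 g α A1 B1 : ZMod q) :
    Function.Injective (sixOf u0 g α A1 B1) := by
  rintro ⟨a1, a2, a3, a4, a5, a6⟩ ⟨b1, b2, b3, b4, b5, b6⟩ h
  simp only [sixOf, Prod.mk.injEq, sub_right_inj] at h
  obtain ⟨rfl, rfl, h3, h4, h5, h6⟩ := h
  simp only [sub_right_inj] at h3 h4 h5 h6
  simp only [h3, h4, h5, h6]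

theorem serverOpen_sixOf (u0 α A1 B1 : ZMod q) (M : Masks q) (t : Six q) :
    serverOpen u0 M (tripleOf α A1 B1 (sixOf u0 (share2 M) α A1 B1 t)).1 = (t.1, t.2.1) := by
  simp [serverOpen, tripleOf, sixOf]

theorem tripleOf_sixOf (u0 g α A1 B1 : ZMod q) (t : Six q) :
    (tripleOf α A1 B1 (sixOf u0 g α A1 B1 t)).2 =
      (t.2.2.1, t.2.2.2.1, t.2.2.2.2.1, t.2.2.2.2.2) := by
  simp [tripleOf, sixOf]

/-- Subtracting `bit · α` (or `bit`) from the decrypted values shifts their weighted sum by `u α`,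
`sign(u)` or `sign(u) α`, because the bits weigh up to the field element. Thus both parties hold
additive shares of these three values. -/
theorem weighted_masks [Fact q.Prime] (u0 u1 α : ZMod q) (v : MaskRnd q)
    (b : BitStr (kappa q + kappa q))
    (hb : b = Fin.append (bitsOf (u0 + u1)) (bitsOf (sgn (u0 + u1)))) :
    share1 (masksOf (unmaskedBy α v b)) = (u0 + u1) * α - weighted v.1 ∧
      share2 (masksOf (unmaskedBy α v b)) = sgn (u0 + u1) - weighted v.2.1 ∧
      share3 (masksOf (unmaskedBy α v b)) = sgn (u0 + u1) * α - weighted v.2.2 := by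
  subst hb
  have e1 : ∀ w z : Fin (kappa q) → ZMod q,
      weighted (fun i => w i - z i) = weighted w - weighted z := by
    intro w z
    simp [weighted, sub_mul, Finset.sum_sub_distrib]
  simp only [share1, share2, share3, masksOf, unmaskedBy, Fin.append_left, Fin.append_right, e1,
    weighted_mul_right, weighted_bitVal_bitsOf]
  simp

/-- The test of `S_0` in terms of what the client sees: it compares the deviations of the client
from the honest opening. -/
theorem openingOk_iff [Fact q.Prime] (u0 u1 α A1 B1 : ZMod q) (v : MaskRnd q)
    (b : BitStr (kappa q + kappa q))
    (hb : b = Fin.append (bitsOf (u0 + u1)) (bitsOf (sgn (u0 + u1)))) (t : Six q)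
    (o : Opening q) :
    openingOk u0 α (masksOf (unmaskedBy α v b))
      (tripleOf α A1 B1 (sixOf u0 (share2 (masksOf (unmaskedBy α v b))) α A1 B1 t)).1 o = true ↔
    o.1 = true ∧
      o.2.1.2 - (weighted v.1 - t.2.2.1) = α * (o.2.1.1 - (u1 - A1)) ∧
      o.2.2.2 - (weighted v.2.2 - t.2.2.2.1) = α * (o.2.2.1 - (weighted v.2.1 - B1)) := by
  have h1 := weighted_masks u0 u1 α v b hb
  rw [openingOk, serverOpen_sixOf]
  simp only [Bool.and_eq_true, decide_eq_true_eq, h1, tripleOf, sixOf]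
  refine and_congr_right fun _ => and_congr ?_ ?_
  -- All terms in `⟨u⟩₀` and `⟨Γ⟩₀` cancel; what remains is the deviation of the client.
  · constructor <;> intro h <;> linear_combination h
  · constructor <;> intro h <;> linear_combination h

/-- For an honest opening, the output shares of `S_0` complement those of the client. -/
theorem finalShares_eq [Fact q.Prime] (u0 u1 α A1 B1 : ZMod q) (v : MaskRnd q)
    (b : BitStr (kappa q + kappa q))
    (hb : b = Fin.append (bitsOf (u0 + u1)) (bitsOf (sgn (u0 + u1)))) (t : Six q)
    (o : Opening q) (h1 : o.2.1.1 = u1 - A1) (h2 : o.2.2.1 = weighted v.2.1 - B1) :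
    finalShares u0 α (masksOf (unmaskedBy α v b))
      (tripleOf α A1 B1 (sixOf u0 (share2 (masksOf (unmaskedBy α v b))) α A1 B1 t)).1 o =
    (α * (u0 + u1) - weighted v.1,
      relu (u0 + u1) - (t.2.2.2.2.1 + (t.1 + (u1 - A1)) * B1 +
        (t.2.1 + (weighted v.2.1 - B1)) * A1),
      α * relu (u0 + u1) - (t.2.2.2.2.2 + (t.1 + (u1 - A1)) * t.2.2.2.1 +
        (t.2.1 + (weighted v.2.1 - B1)) * t.2.2.1)) := by
  have h := weighted_masks u0 u1 α v b hb
  rw [finalShares, serverOpen_sixOf]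
  simp only [h, tripleOf, sixOf, h1, h2, relu, Prod.mk.injEq]
  -- Beaver's identity: here `A + Γ = u` and `B + Λ = sign(u)`, so `AB + ΓB + ΛA + ΓΛ = u ·
  -- sign(u)`.
  refine ⟨?_, ?_, ?_⟩ <;> ring

end ChangeOfVariables

/-! ## The view of the client and the simulator -/

section Client

variable {p : ℕ → ℕ} {G : GarblingScheme}
  {booln : ∀ lam, BoolCircuit (kappa (p lam) + kappa (p lam)) (kappa (p lam) + kappa (p lam))}

/-- The choices that determine the view of the client: its coins, the coins of the simulator of the
garbling scheme, the ciphertexts that cannot be opened, the decrypted values `(c, d, e)`, and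
`(⟨Γ⟩₀, ⟨Λ⟩₀, ⟨αA⟩₁, ⟨αB⟩₁, ⟨C⟩₁, ⟨αC⟩₁)`. -/
abbrev ClientRnd (Adv : Adversary p (protoLen G booln)) (nb nf : ℕ → ℕ) (lam : ℕ) : Type :=
  Coins (p lam) (Adv.nb lam) (Adv.nf lam) × Coins (p lam) (nb lam) (nf lam) × Pads (p lam) ×
    MaskRnd (p lam) × Six (p lam)

variable {Adv : Adversary p (protoLen G booln)} {nb nf : ℕ → ℕ} {lam : ℕ}

/-- The first message to the client with a simulated garbled circuit. -/
def simMsg1 (S : ∀ lam, Circ (p lam) (Coins (p lam) (nb lam) (nf lam))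
      (BitStr (protoLen G booln lam) × (Fin (kappa (p lam) + kappa (p lam)) → Label lam)))
    (x : Coins (p lam) (nb lam) (nf lam)) (o : Pads (p lam)) (v : MaskRnd (p lam)) :
    Msg1 (p lam) lam (protoLen G booln lam) :=
  let y := (S lam).eval x
  msg1Of (G.gcEval lam (booln lam) y.1 y.2) y v o

variable (S : ∀ lam, Circ (p lam) (Coins (p lam) (nb lam) (nf lam))
      (BitStr (protoLen G booln lam) × (Fin (kappa (p lam) + kappa (p lam)) → Label lam)))

namespace ClientRnd

/-- The view of the client. -/
def view (v : ClientRnd Adv nb nf lam) : Adv.View lam :=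
  (v.1, simMsg1 S v.2.1 v.2.2.1 v.2.2.2.1,
    (v.2.2.2.2.2.2.1, v.2.2.2.2.2.2.2.1, v.2.2.2.2.2.2.2.2.1, v.2.2.2.2.2.2.2.2.2),
    (v.2.2.2.2.1, v.2.2.2.2.2.1))

/-- The input that the client uses in the oblivious transfers. -/
def input (v : ClientRnd Adv nb nf lam) : ZMod (p lam) :=
  ofBits (p lam) ((Adv.choose1 lam).eval v.1)

/-- The shares `⟨A⟩₁, ⟨B⟩₁`. -/
def shares (v : ClientRnd Adv nb nf lam) : ZMod (p lam) × ZMod (p lam) :=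
  (Adv.choose2 lam).eval (v.1, simMsg1 S v.2.1 v.2.2.1 v.2.2.2.1)

/-- The last message of the client. -/
def opening (v : ClientRnd Adv nb nf lam) : Opening (p lam) := (Adv.choose3 lam).eval (v.view S)

/-- The client does not abort and opens honestly. -/
def honest (v : ClientRnd Adv nb nf lam) : Bool :=
  (v.opening S).1 &&
    ((decide ((v.opening S).2.1.1 = v.input - (v.shares S).1) &&
      decide ((v.opening S).2.1.2 = weighted v.2.2.2.1.1 - v.2.2.2.2.2.2.1)) &&
    (decide ((v.opening S).2.2.1 = weighted v.2.2.2.1.2.1 - (v.shares S).2) &&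
      decide ((v.opening S).2.2.2 = weighted v.2.2.2.1.2.2 - v.2.2.2.2.2.2.2.1)))

/-- The multiples of `Γ` and `Λ` in the shares of the client of `f(u)` and `α f(u)`. -/
def cross (v : ClientRnd Adv nb nf lam) : ZMod (p lam) × ZMod (p lam) :=
  ((v.2.2.2.2.1 + (v.input - (v.shares S).1)) * (v.shares S).2 +
      (v.2.2.2.2.2.1 + (weighted v.2.2.2.1.2.1 - (v.shares S).2)) * (v.shares S).1,
    (v.2.2.2.2.1 + (v.input - (v.shares S).1)) * v.2.2.2.2.2.2.2.1 +
      (v.2.2.2.2.2.1 + (weighted v.2.2.2.1.2.1 - (v.shares S).2)) * v.2.2.2.2.2.2.1)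

/-- The output of `S_0` in the ideal execution. -/
def idealOut (v : ClientRnd Adv nb nf lam) (u0 α : ZMod (p lam)) : ServerOut (p lam) :=
  outputIf (v.honest S) (α * (u0 + v.input) - weighted v.2.2.2.1.1,
    relu (u0 + v.input) - (v.2.2.2.2.2.2.2.2.1 + (v.cross S).1),
    α * relu (u0 + v.input) - (v.2.2.2.2.2.2.2.2.2 + (v.cross S).2))

/-- The output of the circuit. -/
def bits (v : ClientRnd Adv nb nf lam) (u0 : ZMod (p lam)) :
    BitStr (kappa (p lam) + kappa (p lam)) :=
  (booln lam).eval (Fin.append (bitsOf u0) ((Adv.choose1 lam).eval v.1))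

/-- The masks of `S_0`. -/
def masks (v : ClientRnd Adv nb nf lam) (u0 α : ZMod (p lam)) : MaskRnd (p lam) :=
  unmaskedBy α v.2.2.2.1 (v.bits u0)

/-- The shares of `S_0` of the triple. -/
def triple (v : ClientRnd Adv nb nf lam) (u0 α : ZMod (p lam)) : Six (p lam) :=
  sixOf u0 (share2 (masksOf (v.masks u0 α))) α (v.shares S).1 (v.shares S).2 v.2.2.2.2

/-- The output of `S_0` in the real execution with a simulated garbled circuit. -/
def realOut (v : ClientRnd Adv nb nf lam) (u0 α : ZMod (p lam)) : ServerOut (p lam) :=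
  serverFinish u0 α (masksOf (v.masks u0 α))
    (tripleOf α (v.shares S).1 (v.shares S).2 (v.triple S u0 α)).1 (v.opening S)

/-- The random choices of the real execution with a simulated garbled circuit. -/
def toExec (v : ClientRnd Adv nb nf lam) (u0 α : ZMod (p lam)) :
    (ExecRnd Adv lam × Pads (p lam)) × Coins (p lam) (nb lam) (nf lam) :=
  ((((α, v.1), ((v.masks u0 α).1, (v.masks u0 α).2.1, (v.masks u0 α).2.2, v.triple S u0 α)),
    v.2.2.1), v.2.1)

/-- The masks and triple shares were solved for so that the client receives exactly the prescribed
values. The view on the right therefore contains neither `u0` nor `α`. -/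
theorem run_toExec (v : ClientRnd Adv nb nf lam) (u0 α : ZMod (p lam)) :
    (v.toExec S u0 α).1.1.run u0 ((S lam).eval (v.toExec S u0 α).2) (v.toExec S u0 α).1.2 =
      (α, v.realOut S u0 α, v.view S) := by
  have h1 : (v.toExec S u0 α).1.1.masks = v.masks u0 α := rfl
  have h2 : maskedBy α (v.masks u0 α)
      ((booln lam).eval ((v.toExec S u0 α).1.1.input u0)) = v.2.2.2.1 :=
    maskedBy_unmaskedBy _ _ _
  have h3 : ∀ y o, (v.toExec S u0 α).1.1.run u0 y o =
      outcome Adv lam u0 α v.1 (v.masks u0 α) (v.triple S u0 α)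
        (msg1Of (G.gcEval lam (booln lam) y.1 y.2) y v.2.2.2.1 o) := by
    intro y o
    rw [ExecRnd.run, h1]
    exact congrArg (fun m => outcome Adv lam u0 α v.1 (v.masks u0 α) (v.triple S u0 α)
        (msg1Of (G.gcEval lam (booln lam) y.1 y.2) y m o)) h2
  rw [h3]
  have h4 := tripleOf_sixOf u0 (share2 (masksOf (v.masks u0 α))) α (v.shares S).1 (v.shares S).2
    v.2.2.2.2
  have h5 := serverOpen_sixOf u0 α (v.shares S).1 (v.shares S).2 (masksOf (v.masks u0 α))
    v.2.2.2.2
  change (let m1 := simMsg1 S v.2.1 v.2.2.1 v.2.2.2.1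
    let t := tripleOf α (v.shares S).1 (v.shares S).2 (v.triple S u0 α)
    let m2 := (t.2, serverOpen u0 (masksOf (v.masks u0 α)) t.1)
    let o := (Adv.choose3 lam).eval (v.1, m1, m2)
    (α, serverFinish u0 α (masksOf (v.masks u0 α)) t.1 o, (v.1, m1, m2))) = _
  dsimp only
  rw [triple, h4, h5]
  rfl

/-- The key, the coins and the closed ciphertexts are copied. They fix the unmasking, which gives
back `(c, d, e)`; only then are `⟨A⟩₁, ⟨B⟩₁` and the share of `g₂` known, and the triple shares can
be inverted. -/
theorem toExec_injective (u0 : ZMod (p lam)) :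
    Function.Injective fun va : ClientRnd Adv nb nf lam × ZMod (p lam) =>
      va.1.toExec S u0 va.2 := by
  rintro ⟨⟨r, x, o, v, t⟩, α⟩ ⟨⟨r', x', o', v', t'⟩, α'⟩ h
  simp only [toExec, Prod.mk.injEq] at h
  obtain ⟨⟨⟨⟨rfl, rfl⟩, h1, h2, h3, h4⟩, rfl⟩, rfl⟩ := h
  have hv : v = v' := unmaskedBy_injective _ _ (Prod.ext h1 (Prod.ext h2 h3))
  subst hv
  have ht : t = t' := sixOf_injective _ _ _ _ _ h4
  rw [ht]

end ClientRnd

end Client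

/-! ### The statistical error of the MAC test -/

section Statistical

variable {p : ℕ → ℕ} {G : GarblingScheme}
  {booln : ∀ lam, BoolCircuit (kappa (p lam) + kappa (p lam)) (kappa (p lam) + kappa (p lam))}
  {Adv : Adversary p (protoLen G booln)} {nb nf : ℕ → ℕ} {lam : ℕ}
  (S : ∀ lam, Circ (p lam) (Coins (p lam) (nb lam) (nf lam))
      (BitStr (protoLen G booln lam) × (Fin (kappa (p lam) + kappa (p lam)) → Label lam)))
  [∀ lam, Fact (p lam).Prime]

/-- The execution with a simulated garbled circuit in terms of the view of the client, which is
independent of the MAC key. -/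
theorem simExec_eq (u0 : ZMod (p lam)) :
    ((unif (ExecRnd Adv lam × Pads (p lam))).bind fun w =>
      (unif (Coins (p lam) (nb lam) (nf lam))).map fun x =>
        w.1.run u0 ((S lam).eval x) w.2) =
      (unif (ClientRnd Adv nb nf lam)).bind fun v => (unif (ZMod (p lam))).bind fun α =>
        PMF.pure (α, v.realOut S u0 α, v.view S) := by
  simp only [← PMF.bind_pure_comp]
  rw [unif_bind_prod (fun (v : ClientRnd Adv nb nf lam) (α : ZMod (p lam)) =>
      PMF.pure (α, v.realOut S u0 α, v.view S)),
    unif_bind_prod (fun (w : ExecRnd Adv lam × Pads (p lam))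
      (x : Coins (p lam) (nb lam) (nf lam)) =>
        (PMF.pure ∘ fun x => w.1.run u0 ((S lam).eval x) w.2) x)]
  -- A mere regrouping of coordinates, used only to compare cardinalities; bijectivity then follows
  -- from injectivity.
  let e : ClientRnd Adv nb nf lam × ZMod (p lam) ≃
      (ExecRnd Adv lam × Pads (p lam)) × Coins (p lam) (nb lam) (nf lam) :=
    { toFun := fun z => ((((z.2, z.1.1), (z.1.2.2.2.1.1, z.1.2.2.2.1.2.1, z.1.2.2.2.1.2.2,
        z.1.2.2.2.2)), z.1.2.2.1), z.1.2.1)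
      invFun := fun y => ((y.1.1.1.2, y.2, y.1.2, (y.1.1.2.1, y.1.1.2.2.1, y.1.1.2.2.2.1),
        y.1.1.2.2.2.2), y.1.1.1.1)
      left_inv := fun _ => rfl
      right_inv := fun _ => rfl }
  have hbij := (Fintype.bijective_iff_injective_and_card _).2
    ⟨ClientRnd.toExec_injective (Adv := Adv) S u0, Fintype.card_congr e⟩
  rw [← unif_bind_of_bijective hbij]
  congr 1
  funext va
  exact congrArg PMF.pure (va.1.run_toExec S u0 va.2)

namespace ClientRnd

/-- A malicious client may use a bit string that is not a canonical representative. The circuit is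
specified on all strings modulo `p`, so the extracted input is the value of the string. -/
theorem bits_eq (hB : ComputesSign (p lam) (booln lam)) (v : ClientRnd Adv nb nf lam)
    (u0 : ZMod (p lam)) :
    v.bits u0 = Fin.append (bitsOf (u0 + v.input)) (bitsOf (sgn (u0 + v.input))) := by
  rw [bits, hB, ofBits_bitsOf]
  rfl

/-- If the client opens honestly, then the outputs in both executions agree. -/
theorem realOut_of_honest (hB : ComputesSign (p lam) (booln lam)) (v : ClientRnd Adv nb nf lam)
    (u0 α : ZMod (p lam)) (h : v.honest S = true) : v.realOut S u0 α = v.idealOut S u0 α := by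
  have hh := h
  simp only [honest, Bool.and_eq_true, decide_eq_true_eq] at hh
  obtain ⟨h0, ⟨h1, h2⟩, h3, h4⟩ := hh
  have hok := (openingOk_iff u0 v.input α (v.shares S).1 (v.shares S).2 v.2.2.2.1 _
    (v.bits_eq hB u0) v.2.2.2.2 (v.opening S)).2 ⟨h0, by rw [h1, h2]; ring, by rw [h3, h4]; ring⟩
  rw [realOut, serverFinish_eq, idealOut, h]
  refine congrArg₂ outputIf hok ?_
  rw [triple, masks, finalShares_eq u0 v.input α _ _ v.2.2.2.1 _ (v.bits_eq hB u0) _ _ h1 h3]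
  simp only [cross, add_assoc]

/-- The outputs in both executions differ for one MAC key at most. -/
theorem eq_of_realOut_ne (hB : ComputesSign (p lam) (booln lam)) (v : ClientRnd Adv nb nf lam)
    (u0 α α' : ZMod (p lam)) (h : v.realOut S u0 α ≠ v.idealOut S u0 α)
    (h' : v.realOut S u0 α' ≠ v.idealOut S u0 α') : α = α' := by
  have hh : v.honest S = false := by
    by_contra hc
    exact h (v.realOut_of_honest S hB u0 α (by simpa using hc))
  -- For a dishonest opening the ideal output is an abort, so a different real output means that the
  -- test was passed.
  have key : ∀ β, v.realOut S u0 β ≠ v.idealOut S u0 β →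
      (v.opening S).1 = true ∧
      (v.opening S).2.1.2 - (weighted v.2.2.2.1.1 - v.2.2.2.2.2.2.1) =
        β * ((v.opening S).2.1.1 - (v.input - (v.shares S).1)) ∧
      (v.opening S).2.2.2 - (weighted v.2.2.2.1.2.2 - v.2.2.2.2.2.2.2.1) =
        β * ((v.opening S).2.2.1 - (weighted v.2.2.2.1.2.1 - (v.shares S).2)) := by
    intro β hβ
    refine (openingOk_iff u0 v.input β (v.shares S).1 (v.shares S).2 v.2.2.2.1 _
      (v.bits_eq hB u0) v.2.2.2.2 (v.opening S)).1 ?_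
    by_contra hc
    refine hβ ?_
    rw [realOut, serverFinish_eq, idealOut, hh]
    have hf := Bool.eq_false_iff.2 hc
    exact (congrArg (fun b => outputIf b _) hf).trans rfl
  obtain ⟨h0, h1, h2⟩ := key α h
  obtain ⟨-, h1', h2'⟩ := key α' h'
  by_contra hne
  -- Two distinct keys satisfying the same linear equations force both slopes to vanish, hence also
  -- the MAC deviations, which contradicts dishonesty.
  have e1 : (α - α') * ((v.opening S).2.1.1 - (v.input - (v.shares S).1)) = 0 := by
    linear_combination h1' - h1
  have e2 : (α - α') * ((v.opening S).2.2.1 - (weighted v.2.2.2.1.2.1 - (v.shares S).2)) = 0 := by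
    linear_combination h2' - h2
  replace e1 := (mul_eq_zero.1 e1).resolve_left (sub_ne_zero.2 hne)
  replace e2 := (mul_eq_zero.1 e2).resolve_left (sub_ne_zero.2 hne)
  rw [e1, mul_zero] at h1
  rw [e2, mul_zero] at h2
  have : v.honest S = true := by
    simp only [honest, Bool.and_eq_true, decide_eq_true_eq]
    exact ⟨h0, ⟨sub_eq_zero.1 e1, sub_eq_zero.1 h1⟩, sub_eq_zero.1 e2, sub_eq_zero.1 h2⟩
  simp [hh] at this

end ClientRnd

/-- The statistical distance of the execution with a simulated garbled circuit and the ideal one. -/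
theorem abs_accept_realOut_sub_le (hB : ComputesSign (p lam) (booln lam)) (u0 : ZMod (p lam))
    (D : ZMod (p lam) × ServerOut (p lam) × Adv.View lam → Bool) :
    |accept D ((unif (ClientRnd Adv nb nf lam)).bind fun v => (unif (ZMod (p lam))).bind fun α =>
        PMF.pure (α, v.realOut S u0 α, v.view S)) -
      accept D ((unif (ClientRnd Adv nb nf lam)).bind fun v => (unif (ZMod (p lam))).bind fun α =>
        PMF.pure (α, v.idealOut S u0 α, v.view S))| ≤ (1 / 2 : ℝ) ^ Nat.log 2 (p lam) := by
  -- The view is fixed first; only the key remains random.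
  refine abs_accept_unif_bind_le D _ _ fun v => ?_
  refine (abs_accept_unif_pure_le D _ _ fun α α' h h' => ?_).trans ?_
  · refine v.eq_of_realOut_ne S hB u0 α α' (fun hc => h ?_) (fun hc => h' ?_)
    · rw [hc]
    · rw [hc]
  · rw [ZMod.card, one_div_pow]
    have h2 : 2 ^ Nat.log 2 (p lam) ≤ p lam :=
      Nat.pow_log_le_self 2 (Fact.out : (p lam).Prime).ne_zero
    exact one_div_le_one_div_of_le (by positivity) (by exact_mod_cast h2)

end Statistical

/-! ### Agreement of the simulated view with the shares of the ideal functionality -/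

section Simulation

variable {p : ℕ → ℕ} {G : GarblingScheme}
  {booln : ∀ lam, BoolCircuit (kappa (p lam) + kappa (p lam)) (kappa (p lam) + kappa (p lam))}
  {nb nf : ℕ → ℕ}

/-- The random choices of the simulator: those of the client without `⟨C⟩₁, ⟨αC⟩₁`. -/
abbrev SimRnd (Adv : Adversary p (protoLen G booln)) (nb nf : ℕ → ℕ) (lam : ℕ) : Type :=
  Coins (p lam) (Adv.nb lam) (Adv.nf lam) × Coins (p lam) (nb lam) (nf lam) × Pads (p lam) ×
    MaskRnd (p lam) × (ZMod (p lam) × ZMod (p lam) × ZMod (p lam) × ZMod (p lam))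

variable {Adv : Adversary p (protoLen G booln)} {lam : ℕ}
  (S : ∀ lam, Circ (p lam) (Coins (p lam) (nb lam) (nf lam))
      (BitStr (protoLen G booln lam) × (Fin (kappa (p lam) + kappa (p lam)) → Label lam)))

/-- The choices of the client, with given values of `⟨C⟩₁, ⟨αC⟩₁` and share `k` of `αu`. -/
def SimRnd.extend (s : SimRnd Adv nb nf lam) (k c d : ZMod (p lam)) : ClientRnd Adv nb nf lam :=
  (s.1, s.2.1, s.2.2.1, (adjust s.2.2.2.1.1 k, s.2.2.2.1.2),
    (s.2.2.2.2.1, s.2.2.2.2.2.1, s.2.2.2.2.2.2.1, s.2.2.2.2.2.2.2, c, d))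

/-- The choices of the client that are consistent with the shares `w` returned by the ideal
functionality. -/
def SimRnd.complete (s : SimRnd Adv nb nf lam) (w : ZMod (p lam) × ZMod (p lam) × ZMod (p lam)) :
    ClientRnd Adv nb nf lam :=
  s.extend w.1 (w.2.1 - ((s.extend w.1 0 0).cross S).1) (w.2.2 - ((s.extend w.1 0 0).cross S).2)

/-- The cross terms involve neither `⟨C⟩₁` nor `⟨αC⟩₁`, since the client fixes `⟨A⟩₁, ⟨B⟩₁` before
receiving them. Hence solving for these two shares is not circular, and zeros may stand in for them.
-/
theorem SimRnd.cross_complete (s : SimRnd Adv nb nf lam)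
    (w : ZMod (p lam) × ZMod (p lam) × ZMod (p lam)) :
    (s.complete S w).cross S = (s.extend w.1 0 0).cross S := rfl

/-- Equal completions have equal cross terms, so the functionality's last two shares can be read
off; its first share is the weighted sum of `c`. Only the overwritten first entry of `c` has to be
supplied. -/
theorem SimRnd.complete_injective {s s' : SimRnd Adv nb nf lam}
    {w w' : ZMod (p lam) × ZMod (p lam) × ZMod (p lam)} (i0 : Fin (kappa (p lam)))
    (hi : (i0 : ℕ) = 0) (h : s.complete S w = s'.complete S w')
    (h0 : s.2.2.2.1.1 i0 = s'.2.2.2.1.1 i0) : s = s' ∧ w = w' := by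
  have hc : (s.extend w.1 0 0).cross S = (s'.extend w'.1 0 0).cross S := by
    rw [← SimRnd.cross_complete, h, SimRnd.cross_complete]
  obtain ⟨r, x, o, ⟨c, de⟩, g1, g2, g3, g4⟩ := s
  obtain ⟨r', x', o', ⟨c', de'⟩, g1', g2', g3', g4'⟩ := s'
  obtain ⟨k, t, d⟩ := w
  obtain ⟨k', t', d'⟩ := w'
  simp only [SimRnd.complete, hc] at h
  simp only [SimRnd.extend, Prod.mk.injEq, sub_left_inj] at h
  obtain ⟨rfl, rfl, rfl, ⟨hk, rfl⟩, rfl, rfl, rfl, rfl, rfl, rfl⟩ := h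
  obtain ⟨rfl, rfl⟩ := adjust_injective i0 hi hk h0
  exact ⟨rfl, rfl⟩

/-- Three returned shares replace the two coordinates `⟨C⟩₁, ⟨αC⟩₁`, which leaves one field element
too many: the original first entry of `c`. Recording it makes the completion a bijection, and
forgetting it afterwards leaves the client's choices uniform. -/
theorem SimRnd.unif_bind_complete [∀ lam, Fact (p lam).Prime] {E : Type}
    (F : ClientRnd Adv nb nf lam → PMF E) :
    ((unif (SimRnd Adv nb nf lam × (ZMod (p lam) × ZMod (p lam) × ZMod (p lam)))).bind fun z =>
      F (z.1.complete S z.2)) = (unif (ClientRnd Adv nb nf lam)).bind F := by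
  let i0 : Fin (kappa (p lam)) := ⟨0, kappa_pos _⟩
  let f : SimRnd Adv nb nf lam × (ZMod (p lam) × ZMod (p lam) × ZMod (p lam)) →
      ClientRnd Adv nb nf lam × ZMod (p lam) := fun z => (z.1.complete S z.2, z.1.2.2.2.1.1 i0)
  let e : SimRnd Adv nb nf lam × (ZMod (p lam) × ZMod (p lam) × ZMod (p lam)) ≃
      ClientRnd Adv nb nf lam × ZMod (p lam) :=
    { toFun := fun z => ((z.1.1, z.1.2.1, z.1.2.2.1, z.1.2.2.2.1, (z.1.2.2.2.2.1, z.1.2.2.2.2.2.1,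
        z.1.2.2.2.2.2.2.1, z.1.2.2.2.2.2.2.2, z.2.1, z.2.2.1)), z.2.2.2)
      invFun := fun y => ((y.1.1, y.1.2.1, y.1.2.2.1, y.1.2.2.2.1, (y.1.2.2.2.2.1,
        y.1.2.2.2.2.2.1, y.1.2.2.2.2.2.2.1, y.1.2.2.2.2.2.2.2.1)),
        (y.1.2.2.2.2.2.2.2.2.1, y.1.2.2.2.2.2.2.2.2.2, y.2))
      left_inv := fun _ => rfl
      right_inv := fun _ => rfl }
  have hf : Function.Bijective f := by
    refine (Fintype.bijective_iff_injective_and_card _).2 ⟨fun z z' h => ?_, Fintype.card_congr e⟩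
    simp only [f, Prod.mk.injEq] at h
    obtain ⟨h1, h2⟩ := SimRnd.complete_injective S i0 rfl h.1 h.2
    exact Prod.ext h1 h2
  have h := unif_bind_of_bijective hf fun y => F y.1
  rw [unif_bind_fst] at h
  exact h

theorem SimRnd.samplable : Samplable (p lam) (SimRnd Adv nb nf lam) :=
  (Samplable.coins _ _).prod ((Samplable.coins _ _).prod
    (((Samplable.bitStrs _ _).prod (Samplable.bitStrs _ _)).prod
      (((Samplable.field _).prod ((Samplable.field _).prod (Samplable.field _))).prod
        (Samplable.zmod.prod (Samplable.zmod.prod (Samplable.zmod.prod Samplable.zmod))))))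

end Simulation

/-! ### Efficiency of the simulator -/

section SimulatorEfficient

variable {p : ℕ → ℕ} {G : GarblingScheme}
  {booln : ∀ lam, BoolCircuit (kappa (p lam) + kappa (p lam)) (kappa (p lam) + kappa (p lam))}
  {nb nf : ℕ → ℕ} {Adv : Adversary p (protoLen G booln)}
  {S : ∀ lam, Circ (p lam) (Coins (p lam) (nb lam) (nf lam))
      (BitStr (protoLen G booln lam) × (Fin (kappa (p lam) + kappa (p lam)) → Label lam))}
  {ι X : ℕ → Type} {v : ∀ lam, ι lam → X lam → ClientRnd Adv nb nf lam}

theorem EffFam.simMsg1 (hn : PolyBounded fun lam => kappa (p lam))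
    (hSize : PolyBounded fun lam => (booln lam).size) (hEff : G.Efficient p)
    (hS : PolyBounded fun lam => (S lam).size) (hv : EffFam p v) :
    EffFam p (fun lam i x => simMsg1 S (v lam i x).2.1 (v lam i x).2.2.1 (v lam i x).2.2.2.1) := by
  obtain ⟨E, hE, he⟩ := hEff _ _ booln ⟨hn.add hn, hn.add hn, hSize⟩
  have hy := EffFam.comp (EffFam.of_circ (ι := ι) S hS) hv.snd.fst
  have hev := EffFam.comp (EffFam.of_circ (ι := ι) E hE) hy
  have h := EffFam.msg1Of hn hev hy hv.snd.snd.snd.fst hv.snd.snd.fst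
  have he' : ∀ lam y, (E lam).eval y = G.gcEval lam (booln lam) y.1 y.2 :=
    fun lam y => he lam y.1 y.2
  simp only [he'] at h
  exact h

theorem EffFam.view (hn : PolyBounded fun lam => kappa (p lam))
    (hSize : PolyBounded fun lam => (booln lam).size) (hEff : G.Efficient p)
    (hS : PolyBounded fun lam => (S lam).size)
    (hv : EffFam p v) : EffFam p (fun lam i x => (v lam i x).view S) := by
  have ht := hv.snd.snd.snd.snd
  exact hv.fst.pair ((EffFam.simMsg1 hn hSize hEff hS hv).pair
    ((ht.snd.snd.fst.pair (ht.snd.snd.snd.fst.pair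
      (ht.snd.snd.snd.snd.fst.pair ht.snd.snd.snd.snd.snd))).pair (ht.fst.pair ht.snd.fst)))

theorem EffFam.clientInput (hn : PolyBounded fun lam => kappa (p lam)) (hAdv : Adv.PolySize)
    (hv : EffFam p v) : EffFam p (fun lam i x => (v lam i x).input) :=
  EffFam.ofBits hn (EffFam.comp (EffFam.of_circ (ι := ι) Adv.choose1 hAdv.1) hv.fst)

theorem EffFam.shares (hn : PolyBounded fun lam => kappa (p lam))
    (hSize : PolyBounded fun lam => (booln lam).size) (hEff : G.Efficient p)
    (hS : PolyBounded fun lam => (S lam).size)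
    (hAdv : Adv.PolySize) (hv : EffFam p v) : EffFam p (fun lam i x => (v lam i x).shares S) :=
  have h := EffFam.comp (EffFam.of_circ (ι := ι) Adv.choose2 hAdv.2.1)
    (hv.fst.pair (EffFam.simMsg1 hn hSize hEff hS hv))
  h

theorem EffFam.cross (hn : PolyBounded fun lam => kappa (p lam))
    (hSize : PolyBounded fun lam => (booln lam).size) (hEff : G.Efficient p)
    (hS : PolyBounded fun lam => (S lam).size)
    (hAdv : Adv.PolySize) (hv : EffFam p v) : EffFam p (fun lam i x => (v lam i x).cross S) := by
  have ht := hv.snd.snd.snd.snd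
  have hab := EffFam.shares hn hSize hEff hS hAdv hv
  have hΓ := ht.fst.add ((EffFam.clientInput hn hAdv hv).sub hab.fst)
  have hΛ := ht.snd.fst.add ((EffFam.weighted hn hv.snd.snd.snd.fst.snd.fst).sub hab.snd)
  exact ((hΓ.mul hab.snd).add (hΛ.mul hab.fst)).pair
    ((hΓ.mul ht.snd.snd.snd.fst).add (hΛ.mul ht.snd.snd.fst))

theorem EffFam.honest [∀ lam, Fact (p lam).Prime] (hn : PolyBounded fun lam => kappa (p lam))
    (hSize : PolyBounded fun lam => (booln lam).size) (hEff : G.Efficient p)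
    (hS : PolyBounded fun lam => (S lam).size)
    (hAdv : Adv.PolySize) (hv : EffFam p v) : EffFam p (fun lam i x => (v lam i x).honest S) := by
  have ht := hv.snd.snd.snd.snd
  have hm := hv.snd.snd.snd.fst
  have hab := EffFam.shares hn hSize hEff hS hAdv hv
  have ho := EffFam.comp (EffFam.of_circ (ι := ι) Adv.choose3 hAdv.2.2)
    (EffFam.view hn hSize hEff hS hv)
  exact ho.fst.and (((EffFam.decideEq hn ho.snd.fst.fst
      ((EffFam.clientInput hn hAdv hv).sub hab.fst)).and
    (EffFam.decideEq hn ho.snd.fst.snd ((EffFam.weighted hn hm.fst).sub ht.snd.snd.fst))).and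
    ((EffFam.decideEq hn ho.snd.snd.fst ((EffFam.weighted hn hm.snd.fst).sub hab.snd)).and
    (EffFam.decideEq hn ho.snd.snd.snd
      ((EffFam.weighted hn hm.snd.snd).sub ht.snd.snd.snd.fst))))

theorem EffFam.complete (hn : PolyBounded fun lam => kappa (p lam))
    (hSize : PolyBounded fun lam => (booln lam).size) (hEff : G.Efficient p)
    (hS : PolyBounded fun lam => (S lam).size)
    (hAdv : Adv.PolySize) {s : ∀ lam, ι lam → X lam → SimRnd Adv nb nf lam}
    {w : ∀ lam, ι lam → X lam → ZMod (p lam) × ZMod (p lam) × ZMod (p lam)}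
    (hs : EffFam p s) (hw : EffFam p w) :
    EffFam p (fun lam i x => (s lam i x).complete S (w lam i x)) := by
  -- Needed twice: with zeros to compute the cross terms, then with the final values.
  have hext : ∀ {c d : ∀ lam, ι lam → X lam → ZMod (p lam)}, EffFam p c → EffFam p d →
      EffFam p (fun lam i x => (s lam i x).extend (w lam i x).1 (c lam i x) (d lam i x)) := by
    intro c d hc hd
    have hg := hs.snd.snd.snd.snd
    exact hs.fst.pair (hs.snd.fst.pair (hs.snd.snd.fst.pair
      (((EffFam.adjust hn hs.snd.snd.snd.fst.fst hw.fst).pair hs.snd.snd.snd.fst.snd).pair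
        (hg.fst.pair (hg.snd.fst.pair (hg.snd.snd.fst.pair (hg.snd.snd.snd.pair
          (hc.pair hd))))))))
  have h0 : EffFam p (X := X) (ι := ι) (fun lam _ _ => (0 : ZMod (p lam))) :=
    EffFam.const fun _ _ => 0
  have hcr := EffFam.cross hn hSize hEff hS hAdv (hext h0 h0)
  exact hext (hw.snd.fst.sub hcr.fst) (hw.snd.snd.sub hcr.snd)

end SimulatorEfficient

/-! ### Construction of the simulator and conclusion -/

/-- By construction the client's three output shares for an honest opening are the components of
`w`, so the complementary shares are those that the functionality gives to `S_0`. -/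
theorem SimRnd.idealOut_complete {p : ℕ → ℕ} {G : GarblingScheme}
    {booln : ∀ lam, BoolCircuit (kappa (p lam) + kappa (p lam)) (kappa (p lam) + kappa (p lam))}
    {nb nf : ℕ → ℕ} {Adv : Adversary p (protoLen G booln)} {lam : ℕ} [∀ lam, Fact (p lam).Prime]
    (S : ∀ lam, Circ (p lam) (Coins (p lam) (nb lam) (nf lam))
      (BitStr (protoLen G booln lam) × (Fin (kappa (p lam) + kappa (p lam)) → Label lam)))
    (s : SimRnd Adv nb nf lam) (w : ZMod (p lam) × ZMod (p lam) × ZMod (p lam))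
    (u0 α : ZMod (p lam)) :
    (s.complete S w).idealOut S u0 α = outputIf ((s.complete S w).honest S)
      (α * (u0 + ofBits (p lam) ((Adv.choose1 lam).eval s.1)) - w.1,
        relu (u0 + ofBits (p lam) ((Adv.choose1 lam).eval s.1)) - w.2.1,
        α * relu (u0 + ofBits (p lam) ((Adv.choose1 lam).eval s.1)) - w.2.2) := by
  have h1 : weighted (s.complete S w).2.2.2.1.1 = w.1 := weighted_adjust (kappa_pos _) _ _
  have h2 : (s.complete S w).2.2.2.2.2.2.2.2.1 + ((s.complete S w).cross S).1 = w.2.1 := by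
    rw [SimRnd.cross_complete]
    exact sub_add_cancel _ _
  have h3 : (s.complete S w).2.2.2.2.2.2.2.2.2 + ((s.complete S w).cross S).2 = w.2.2 := by
    rw [SimRnd.cross_complete]
    exact sub_add_cancel _ _
  rw [ClientRnd.idealOut, h1, h2, h3]
  rfl

/-- There is an efficient simulator whose ideal execution is determined by the view of the client
and an independent MAC key. -/
theorem exists_simulator {p : ℕ → ℕ} {G : GarblingScheme}
    {booln : ∀ lam, BoolCircuit (kappa (p lam) + kappa (p lam)) (kappa (p lam) + kappa (p lam))}
    {nb nf : ℕ → ℕ} {Adv : Adversary p (protoLen G booln)} [∀ lam, Fact (p lam).Prime]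
    {S : ∀ lam, Circ (p lam) (Coins (p lam) (nb lam) (nf lam))
      (BitStr (protoLen G booln lam) × (Fin (kappa (p lam) + kappa (p lam)) → Label lam))}
    (hn : PolyBounded fun lam => kappa (p lam))
    (hSize : PolyBounded fun lam => (booln lam).size) (hEff : G.Efficient p)
    (hS : PolyBounded fun lam => (S lam).size) (hAdv : Adv.PolySize) :
    ∃ T : Simulator p Adv.View, T.PolySize ∧ ∀ lam u0, idealExec T lam u0 =
      (unif (ClientRnd Adv nb nf lam)).bind fun v => (unif (ZMod (p lam))).bind fun α =>
        PMF.pure (α, v.idealOut S u0 α, v.view S) := by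
  choose mb mf c hc0 hc using fun lam =>
    SimRnd.samplable (p := p) (Adv := Adv) (nb := nb) (nf := nf) (lam := lam)
  have hcE : EffFam p (ι := fun _ => Unit) (fun lam _ x => (c lam).eval x) :=
    EffFam.of_circ c ((PolyBounded.const 0).mono (Eventually.of_forall fun lam => (hc0 lam).le))
  -- Extraction: the client's first circuit is run on its simulated coins, and its bits are read as
  -- a field element.
  obtain ⟨I, hI, hIe⟩ := (EffFam.ofBits hn (EffFam.comp
    (EffFam.of_circ (ι := fun _ => Unit) Adv.choose1 hAdv.1) hcE.fst)).exists_circ fun _ => ()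
  have hz : EffFam p (ι := fun _ => Unit) (X := fun lam => Coins (p lam) (mb lam) (mf lam) ×
      (ZMod (p lam) × ZMod (p lam) × ZMod (p lam))) fun _ _ z => z := EffFam.id
  have hv := EffFam.complete hn hSize hEff hS hAdv (EffFam.comp hcE hz.fst) hz.snd
  obtain ⟨J, hJ, hJe⟩ := ((EffFam.honest hn hSize hEff hS hAdv hv).pair
    (EffFam.view hn hSize hEff hS hv)).exists_circ fun _ => ()
  refine ⟨⟨mb, mf, I, J⟩, ⟨hI, hJ⟩, fun lam u0 => ?_⟩
  -- The ideal execution draws the key first; it is independent of the choices of the client.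
  rw [PMF.bind_comm, idealExec]
  simp only [pmf_bind_eq, pmf_pure_eq, hIe, hJe, idealFun, PMF.bind_bind, PMF.pure_bind]
  congr 1
  funext α
  rw [← SimRnd.unif_bind_complete S fun v => PMF.pure (α, v.idealOut S u0 α, v.view S)]
  rw [← unif_bind_prod (fun (s : SimRnd Adv nb nf lam)
    (w : ZMod (p lam) × ZMod (p lam) × ZMod (p lam)) =>
      PMF.pure (α, (s.complete S w).idealOut S u0 α, (s.complete S w).view S)),
    ← unif_bind_of_bijective (hc lam)]
  congr 1
  funext r
  simp only [unif_bind_prod, SimRnd.idealOut_complete]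
  rfl

theorem secureAgainstMaliciousClient {p : ℕ → ℕ} [∀ lam, Fact (p lam).Prime]
    (hlam : ∀ᶠ lam in atTop, 2 * kappa (p lam) < lam)
    {G : GarblingScheme} (hEff : G.Efficient p) (hPP : G.PointAndPermute)
    (hCorr : G.Correct) (hSec : G.Secure p) (hAuth : G.Authentic p)
    {booln : ∀ lam, BoolCircuit (kappa (p lam) + kappa (p lam)) (kappa (p lam) + kappa (p lam))}
    (hSize : PolyBounded fun lam => (booln lam).size)
    (hBooln : ∀ lam, ComputesSign (p lam) (booln lam)) :
    SecureAgainstMaliciousClient p G booln := by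
  intro Adv hAdv
  have hn := PolyBounded.kappa hlam
  obtain ⟨nb, nf, S, hS, hSim⟩ := hSec _ _ booln ⟨hn.add hn, hn.add hn, hSize⟩
  obtain ⟨T, hT, hIdeal⟩ := exists_simulator (Adv := Adv) hn hSize hEff hS hAdv
  refine ⟨T, hT, fun u0 => ?_⟩
  have hReal := indist_realExec_sim hlam hAdv hSize hEff hPP hCorr hAuth hSim u0
  simp only [simExec_eq] at hReal
  have hId : (fun lam => idealExec T lam (u0 lam)) = _ := funext fun lam => hIdeal lam (u0 lam)
  refine ⟨?_, ?_⟩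
  · have hproj : EffFam p (fun lam (_ : Unit)
        (e : ZMod (p lam) × ServerOut (p lam) × Adv.View lam) => (e.1, e.2.2)) :=
      EffFam.id.fst.pair EffFam.id.snd.snd
    refine (hReal.map hproj).trans (indist_of_eventually_eq (Eventually.of_forall fun lam => ?_))
    -- Without the output of `S_0`, both sides are the same view with an independent key.
    simp only [hIdeal, PMF.map_bind, PMF.pure_map]
  · refine hReal.trans_indistUpTo ?_
    rw [hId]
    exact indistUpTo_of_accept_le (Eventually.of_forall fun lam D =>
      abs_accept_realOut_sub_le S (hBooln lam) (u0 lam) D)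

end NonLin

theorem theorem4p1 (p : ℕ → ℕ) [∀ lam, Fact (p lam).Prime]
    (hlam : ∀ᶠ lam in Filter.atTop, 2 * NonLin.kappa (p lam) < lam)
    (G : NonLin.GarblingScheme) (hEff : G.Efficient p) (hPP : G.PointAndPermute)
    (hCorr : G.Correct) (hSec : G.Secure p) (hAuth : G.Authentic p)
    (booln : ∀ lam, NonLin.BoolCircuit
      (NonLin.kappa (p lam) + NonLin.kappa (p lam)) (NonLin.kappa (p lam) + NonLin.kappa (p lam)))
    (hSize : NonLin.PolyBounded fun lam => (booln lam).size)
    (hBooln : ∀ lam, NonLin.ComputesSign (p lam) (booln lam)) :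
    NonLin.SecureAgainstMaliciousClient p G booln :=
  NonLin.secureAgainstMaliciousClient hlam hEff hPP hCorr hSec hAuth hSize hBooln
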